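/- Let INF be the first-order theory with equality, in intuitionistic logic, whose only non-logical symbol is $\in$ and whose axioms are extensionality and stratified comprehension: for every stratified formula $\varphi$ in which $y$ is not free, the set $y=\{x:\varphi\}$ exists. (A formula is stratified if its variables, with bound variables named apart, can be given natural-number types so that each atomic subformula $x\in y$ has $\mathrm{type}(y)=\mathrm{type}(x)+1$ and each atomic subformula $x=y$ has $\mathrm{type}(x)=\mathrm{type}(y)$.) In INF, let $\langle x,y\rangle=\{\{x\},\{x,y\}\}$, let $f\in\mathsf{FUNC}$ mean $\forall x,y,z\,(\langle x,y\rangle\in f\to\langle x,z\rangle\in f\to y=z)$, and let $f(x)=fx=\{u:\exists y\,(\langle x,y\rangle\in f\wedge u\in y)\}$, which is $y$ when $f\in\mathsf{FUNC}$ and $\langle x,y\rangle\in f$; application associates to the left. Put $$\mathbf 0=\{\langle f,\mathsf{id}\rangle : f=f\},\qquad \mathsf{id}=\{\langle x,x\rangle: x=x\},$$ $$\mathsf S=\{\langle z,\{\langle f,p\rangle : f\in\mathsf{FUNC},\ p=p_{f,z}\}\rangle : z\in\mathsf{FUNC}\},$$ where $$p_{f,z}=\{\langle x,w\rangle:\exists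 t,q\,(t\in\mathsf{FUNC}\wedge\langle f,t\rangle\in z\wedge\langle x,q\rangle\in t\wedge\langle q,w\rangle\in f)\}$$ (so $\mathsf S zfx=f(zfx)$), and let $\mathbb N$, the set of Church numbers, be the intersection of all sets that contain $\mathbf 0$ and are closed under $u\mapsto\mathsf S u$. The Church counting axiom is the sentence $\forall j\in\mathbb N\,(j\,\mathsf S\,\mathbf 0=j)$. A set $X$ is (Dedekind) infinite if there are a set $Y\subseteq X$ with $Y\ne X$ and a single-valued relation that is one-to-one from $X$ onto $Y$. **Theorem.** INF proves that the sets $\mathbf 0$, $\mathsf S$, $\mathbb N$ exist, and that the Church counting axiom implies both that $\mathbb N$ is infinite and that Church successor is one-to-one on $\mathbb N$, i.e. $\forall x,y\in\mathbb N\,(\mathsf S x=\mathsf S y\to x=y)$. -/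

import Mathlib

namespace INF

/-- Formulas of first-order set theory (equality and one binary relation symbol `∈`, no function
symbols) whose free variables are among `Fin n`. De Bruijn indices: under a quantifier, `0` is the
bound variable and `i.succ` is the variable that was `i` outside the quantifier. -/
inductive Fml : ℕ → Type
  | mem {n : ℕ} (x y : Fin n) : Fml n
  | eq {n : ℕ} (x y : Fin n) : Fml n
  | bot {n : ℕ} : Fml n
  | and {n : ℕ} (φ ψ : Fml n) : Fml n
  | or {n : ℕ} (φ ψ : Fml n) : Fml n
  | imp {n : ℕ} (φ ψ : Fml n) : Fml n
  | all {n : ℕ} (φ : Fml (n + 1)) : Fml n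
  | ex {n : ℕ} (φ : Fml (n + 1)) : Fml n

/-- Extension of a renaming of variables to one more bound variable. -/
def lift {n m : ℕ} (ρ : Fin n → Fin m) : Fin (n + 1) → Fin (m + 1) :=
  Fin.cases 0 (fun i => (ρ i).succ)

/-- The renaming that substitutes `x` for the variable `0` and lowers the other variables. -/
def inst {n : ℕ} (x : Fin n) : Fin (n + 1) → Fin n :=
  Fin.cases x (fun i => i)

/-- Capture-avoiding substitution of variables for variables. -/
def Fml.rename : {n m : ℕ} → (Fin n → Fin m) → Fml n → Fml m
  | _, _, ρ, .mem x y => .mem (ρ x) (ρ y)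
  | _, _, ρ, .eq x y => .eq (ρ x) (ρ y)
  | _, _, _, .bot => .bot
  | _, _, ρ, .and φ ψ => .and (φ.rename ρ) (ψ.rename ρ)
  | _, _, ρ, .or φ ψ => .or (φ.rename ρ) (ψ.rename ρ)
  | _, _, ρ, .imp φ ψ => .imp (φ.rename ρ) (ψ.rename ρ)
  | _, _, ρ, .all φ => .all (φ.rename (lift ρ))
  | _, _, ρ, .ex φ => .ex (φ.rename (lift ρ))

infix:60 " ∈ₛ " => Fml.mem
infix:60 " =ₛ " => Fml.eq
infixr:45 " ⋏ " => Fml.and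
infixr:40 " ⋎ " => Fml.or
infixr:35 " ⟹ " => Fml.imp

/-- `φ ↔ ψ` -/
def Fml.biimp {n : ℕ} (φ ψ : Fml n) : Fml n := (φ ⟹ ψ) ⋏ (ψ ⟹ φ)

infix:30 " ⟺ₛ " => Fml.biimp

/-- `¬ φ` -/
def Fml.neg {n : ℕ} (φ : Fml n) : Fml n := φ ⟹ .bot

/-- `φ` can be stratified with the free variables having the types `t`: every bound variable can be
given a type such that each atomic formula `x ∈ y` satisfies `type y = type x + 1` and each atomic
formula `x = y` satisfies `type x = type y`. -/
def Fml.StratifiedBy : {n : ℕ} → Fml n → (Fin n → ℕ) → Prop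
  | _, .mem x y, t => t y = t x + 1
  | _, .eq x y, t => t x = t y
  | _, .bot, _ => True
  | _, .and φ ψ, t => φ.StratifiedBy t ∧ ψ.StratifiedBy t
  | _, .or φ ψ, t => φ.StratifiedBy t ∧ ψ.StratifiedBy t
  | _, .imp φ ψ, t => φ.StratifiedBy t ∧ ψ.StratifiedBy t
  | _, .all φ, t => ∃ k : ℕ, φ.StratifiedBy (Fin.cons k t)
  | _, .ex φ, t => ∃ k : ℕ, φ.StratifiedBy (Fin.cons k t)

/-- `φ` is a stratified formula. -/
def Fml.Stratified {n : ℕ} (φ : Fml n) : Prop := ∃ t : Fin n → ℕ, φ.StratifiedBy t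

/-- A hypothesis read under one more quantifier. -/
def Fml.shift {n : ℕ} (φ : Fml n) : Fml (n + 1) := φ.rename Fin.succ

/-- `Proves Γ φ`: the theory INF proves `φ` from the hypotheses `Γ`. This is natural deduction for
intuitionistic first-order logic with equality, with the two non-logical axioms of Quine's NF,
extensionality and stratified comprehension. -/
inductive Proves : {n : ℕ} → List (Fml n) → Fml n → Prop
  -- propositional rules
  | hyp {n : ℕ} {Γ : List (Fml n)} {φ : Fml n} : φ ∈ Γ → Proves Γ φ
  | botE {n : ℕ} {Γ : List (Fml n)} {φ : Fml n} : Proves Γ .bot → Proves Γ φ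
  | andI {n : ℕ} {Γ : List (Fml n)} {φ ψ : Fml n} : Proves Γ φ → Proves Γ ψ → Proves Γ (φ ⋏ ψ)
  | andE₁ {n : ℕ} {Γ : List (Fml n)} {φ ψ : Fml n} : Proves Γ (φ ⋏ ψ) → Proves Γ φ
  | andE₂ {n : ℕ} {Γ : List (Fml n)} {φ ψ : Fml n} : Proves Γ (φ ⋏ ψ) → Proves Γ ψ
  | orI₁ {n : ℕ} {Γ : List (Fml n)} {φ ψ : Fml n} : Proves Γ φ → Proves Γ (φ ⋎ ψ)
  | orI₂ {n : ℕ} {Γ : List (Fml n)} {φ ψ : Fml n} : Proves Γ ψ → Proves Γ (φ ⋎ ψ)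
  | orE {n : ℕ} {Γ : List (Fml n)} {φ ψ χ : Fml n} :
      Proves Γ (φ ⋎ ψ) → Proves (φ :: Γ) χ → Proves (ψ :: Γ) χ → Proves Γ χ
  | impI {n : ℕ} {Γ : List (Fml n)} {φ ψ : Fml n} : Proves (φ :: Γ) ψ → Proves Γ (φ ⟹ ψ)
  | impE {n : ℕ} {Γ : List (Fml n)} {φ ψ : Fml n} : Proves Γ (φ ⟹ ψ) → Proves Γ φ → Proves Γ ψ
  -- quantifier rules
  | allI {n : ℕ} {Γ : List (Fml n)} {φ : Fml (n + 1)} :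
      Proves (Γ.map Fml.shift) φ → Proves Γ (.all φ)
  | allE {n : ℕ} {Γ : List (Fml n)} {φ : Fml (n + 1)} (x : Fin n) :
      Proves Γ (.all φ) → Proves Γ (φ.rename (inst x))
  | exI {n : ℕ} {Γ : List (Fml n)} {φ : Fml (n + 1)} (x : Fin n) :
      Proves Γ (φ.rename (inst x)) → Proves Γ (.ex φ)
  | exE {n : ℕ} {Γ : List (Fml n)} {φ : Fml (n + 1)} {χ : Fml n} :
      Proves Γ (.ex φ) → Proves (φ :: Γ.map Fml.shift) χ.shift → Proves Γ χ
  -- equality rules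
  | eqI {n : ℕ} {Γ : List (Fml n)} (x : Fin n) : Proves Γ (x =ₛ x)
  | eqE {n : ℕ} {Γ : List (Fml n)} (φ : Fml (n + 1)) {x y : Fin n} :
      Proves Γ (x =ₛ y) → Proves Γ (φ.rename (inst x)) → Proves Γ (φ.rename (inst y))
  -- extensionality: `(∀ z, z ∈ x ↔ z ∈ y) → x = y`
  | extensionality {n : ℕ} {Γ : List (Fml n)} (x y : Fin n) :
      Proves Γ (.all (0 ∈ₛ x.succ ⟺ₛ 0 ∈ₛ y.succ) ⟹ x =ₛ y)
  -- comprehension: `∃ y, ∀ x, x ∈ y ↔ φ(x, parameters)` for `φ` stratified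
  | comprehension {n : ℕ} {Γ : List (Fml n)} (φ : Fml (n + 1)) (hφ : φ.Stratified) :
      Proves Γ (.ex (.all (0 ∈ₛ 1 ⟺ₛ φ.rename (lift Fin.succ))))

/-! ### Set-theoretic vocabulary

`all' fun x => φ` and `ex' fun x => φ` are the quantifiers with the bound variable named `x`;
a variable from outside is silently shifted by the coercion below. -/

instance varCoe {n : ℕ} : Coe (Fin n) (Fin (n + 1)) := ⟨Fin.succ⟩

/-- `∀ x, φ x` -/
def all' {n : ℕ} (φ : Fin (n + 1) → Fml (n + 1)) : Fml n := .all (φ 0)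

/-- `∃ x, φ x` -/
def ex' {n : ℕ} (φ : Fin (n + 1) → Fml (n + 1)) : Fml n := .ex (φ 0)

section Vocabulary

variable {n : ℕ}

/-- `x ⊆ y` -/
def subset (x y : Fin n) : Fml n := all' fun z => z ∈ₛ x ⟹ z ∈ₛ y

/-- `p = {x}` -/
def isSingleton (p x : Fin n) : Fml n := all' fun z => z ∈ₛ p ⟺ₛ z =ₛ x

/-- `p = {x, y}` -/
def isUnordered (p x y : Fin n) : Fml n := all' fun z => z ∈ₛ p ⟺ₛ (z =ₛ x ⋎ z =ₛ y)

/-- `p = ⟨x, y⟩`, the (Kuratowski) ordered pair `{{x}, {x, y}}` -/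
def isPair (p x y : Fin n) : Fml n :=
  all' fun u => u ∈ₛ p ⟺ₛ (isSingleton (u : Fin (n + 1)) x ⋎ isUnordered (u : Fin (n + 1)) x y)

/-- `⟨x, y⟩ ∈ f` -/
def pairMem (x y f : Fin n) : Fml n := ex' fun p => isPair p x y ⋏ p ∈ₛ f

/-- `f ∈ FUNC`: `f` is single-valued -/
def isFunc (f : Fin n) : Fml n :=
  all' fun x => all' fun y => all' fun z => pairMem x y f ⟹ pairMem x z f ⟹ y =ₛ z

/-- `Rel(f)`: all members of `f` are ordered pairs -/
def isRel (f : Fin n) : Fml n :=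
  all' fun u => u ∈ₛ f ⟹ ex' fun x => ex' fun y => isPair u x y

/-- `v = Ap(f, x)`, application of `f` to `x`: `v = {u : ∃ y, ⟨x, y⟩ ∈ f ∧ u ∈ y}`.
When `f ∈ FUNC` and `⟨x, y⟩ ∈ f` this says `v = y`. -/
def isAp (v f x : Fin n) : Fml n :=
  all' fun u => u ∈ₛ v ⟺ₛ ex' fun y => pairMem x y f ⋏ u ∈ₛ y

/-- `i = {⟨x, x⟩ : x = x}` -/
def isId (i : Fin n) : Fml n := all' fun u => u ∈ₛ i ⟺ₛ ex' fun x => isPair u x x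

/-- `z` is the Church number zero, `{⟨f, id⟩ : f = f}` -/
def isZero (z : Fin n) : Fml n :=
  all' fun u => u ∈ₛ z ⟺ₛ ex' fun f => ex' fun i => isId i ⋏ isPair u f i

/-- `p = {⟨x, w⟩ : ∃ t q, t ∈ FUNC ∧ ⟨f, t⟩ ∈ z ∧ ⟨x, q⟩ ∈ t ∧ ⟨q, w⟩ ∈ f}`,
that is `p = λ x, f (z f x)` -/
def isStep (p f z : Fin n) : Fml n :=
  all' fun u => u ∈ₛ p ⟺ₛ
    ex' fun x => ex' fun w => ex' fun t => ex' fun q =>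
      isPair u x w ⋏ isFunc t ⋏ pairMem f t z ⋏ pairMem x q t ⋏ pairMem q w f

/-- `v = {⟨f, p⟩ : f ∈ FUNC ∧ p = λ x, f (z f x)}` -/
def isSuccOf (v z : Fin n) : Fml n :=
  all' fun a => a ∈ₛ v ⟺ₛ ex' fun f => ex' fun p => isPair a f p ⋏ isFunc f ⋏ isStep p f z

/-- `s` is Church successor, the set of all `⟨z, {⟨f, p⟩ : f ∈ FUNC ∧ p = λ x, f (z f x)}⟩`
with `z ∈ FUNC` -/
def isSucc (s : Fin n) : Fml n :=
  all' fun b => b ∈ₛ s ⟺ₛ ex' fun z => ex' fun v => isPair b z v ⋏ isFunc z ⋏ isSuccOf v z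

/-- `N` is the intersection of all sets that contain `zero` and are closed under the map
`u ↦ Ap(s, u)` -/
def isLeastClosed (N zero s : Fin n) : Fml n :=
  all' fun x => x ∈ₛ N ⟺ₛ
    all' fun X =>
      (zero ∈ₛ X ⋏ all' fun u => u ∈ₛ X ⟹ ex' fun v => isAp v s u ⋏ v ∈ₛ X) ⟹ x ∈ₛ X

/-- `zero`, `s`, `N` are Church zero, Church successor and the set of Church numbers -/
def isChurch (zero s N : Fin n) : Fml n := isZero zero ⋏ isSucc s ⋏ isLeastClosed N zero s

/-- The Church counting axiom: `∀ j ∈ N, Ap(Ap(j, s), zero) = j` -/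
def churchCounting (zero s N : Fin n) : Fml n :=
  all' fun j => j ∈ₛ N ⟹ ex' fun t => isAp t j s ⋏ isAp j t zero

/-- `f : X → Y`: for each `x ∈ X` there is a unique `y` with `⟨x, y⟩ ∈ f`, and `y ∈ Y` -/
def mapsTo (f X Y : Fin n) : Fml n :=
  all' fun x => x ∈ₛ X ⟹ ex' fun y =>
    pairMem x y f ⋏ y ∈ₛ Y ⋏ all' fun w => pairMem x w f ⟹ w =ₛ y

/-- `f` is one-to-one from `X` to `Y` -/
def oneOne (f X Y : Fin n) : Fml n :=
  mapsTo f X Y ⋏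
  (all' fun x => all' fun u => all' fun y => pairMem x y f ⟹ pairMem u y f ⟹ x =ₛ u) ⋏
  (all' fun x => all' fun y => pairMem x y f ⟹ y ∈ₛ Y ⟹ x ∈ₛ X)

/-- `f` is onto from `X` to `Y` -/
def onto (f X Y : Fin n) : Fml n :=
  all' fun y => y ∈ₛ Y ⟹ ex' fun x => x ∈ₛ X ⋏ pairMem x y f

/-- `X ∼ Y`: there is a functional relation that is one-to-one from `X` onto `Y` -/
def similar (X Y : Fin n) : Fml n :=
  ex' fun f => isRel f ⋏ isFunc f ⋏ oneOne (f : Fin (n + 1)) X Y ⋏ onto (f : Fin (n + 1)) X Y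

/-- `X` is infinite (in Dedekind's sense): it is similar to a proper subset of itself -/
def isInfinite (X : Fin n) : Fml n :=
  ex' fun Y => subset Y X ⋏ (Y =ₛ X).neg ⋏ similar (X : Fin (n + 1)) Y

/-- `s` is one-to-one on `N`: `∀ x y ∈ N, Ap(s, x) = Ap(s, y) → x = y` -/
def oneOneOn (s N : Fin n) : Fml n :=
  all' fun x => x ∈ₛ N ⟹ all' fun y => y ∈ₛ N ⟹
    (ex' fun v => isAp v s x ⋏ isAp v s y) ⟹ x =ₛ y

end Vocabulary

end INF

/-! The argument has two layers. INF is complete for Kripke models (`proves_of_force`), so it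
suffices that the sentence is forced at every world of every model. There sets are actual elements
of a domain, every stratified condition defines one (`sep`), and induction on Church numbers is
available for stratified conditions only.

Inside a model, let `Seg B x` say that `B` behaves as the finite set of Church numbers before `x`;
in particular `x ∉ B`, successor is one-to-one on `B`, and induction holds up to `x`. Let `c` be the
cyclic permutation of `B ∪ {x}` that follows successor on `B` and sends `x` back to `0` (`cycle`).
Induction up to `x` gives `u c 0 = u S 0` for `u ∈ B ∪ {x}`, because `c` and `S` agree until `x` is
reached; the counting axiom then gives `u c 0 = u` (`Seg.it_cycle`). This last equation could not be
the induction statement itself: `u` occurs in it at two types, six apart. Counting bridges that gap.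

If now `S u = S v` with `u, v ∈ B ∪ {x}`, then `c u = c (u c 0) = S u c 0 = S v c 0 = c v`, so `u =
v` because `c` is one-to-one (`Seg.succOf_inj`). Hence `S x` is not in `B ∪ {x}`, and `B ∪ {x}` is a
segment before `S x` (`Seg.next`). Being a segment is a stratified condition, so induction gives
every Church number a segment. Any two Church numbers lie in a common one (`mem_or_exists_seg`), so
successor is one-to-one on the Church numbers. Since `0` is not a successor, the set of Church
numbers is infinite. -/

namespace INF

/-! ### Substitution of variables in formulas and derivations -/

section Renaming

@[simp] theorem lift_zero {n m : ℕ} (ρ : Fin n → Fin m) : lift ρ 0 = 0 := rfl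

@[simp] theorem lift_succ {n m : ℕ} (ρ : Fin n → Fin m) (i : Fin n) :
    lift ρ i.succ = (ρ i).succ := rfl

theorem lift_comp {n m k : ℕ} (σ : Fin m → Fin k) (ρ : Fin n → Fin m) :
    lift σ ∘ lift ρ = lift (σ ∘ ρ) := by
  funext i; refine Fin.cases rfl (fun _ => rfl) i

theorem lift_id {n : ℕ} : lift (id : Fin n → Fin n) = id := by
  funext i; refine Fin.cases rfl (fun _ => rfl) i

theorem comp_inst {n m : ℕ} (ρ : Fin n → Fin m) (x : Fin n) :
    ρ ∘ inst x = inst (ρ x) ∘ lift ρ := by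
  funext i; refine Fin.cases rfl (fun _ => rfl) i

theorem lift_injective {n m : ℕ} {ρ : Fin n → Fin m} (h : ρ.Injective) :
    (lift ρ).Injective := by
  intro i j
  refine Fin.cases ?_ (fun i => ?_) i <;> refine Fin.cases ?_ (fun j => ?_) j
  · simp
  · simp [eq_comm, Fin.succ_ne_zero]
  · simp [Fin.succ_ne_zero]
  · simpa using fun e => h e

theorem Fml.rename_rename {n m k : ℕ} (σ : Fin m → Fin k) (ρ : Fin n → Fin m) (φ : Fml n) :
    (φ.rename ρ).rename σ = φ.rename (σ ∘ ρ) := by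
  induction φ generalizing m k with
  | mem | eq | bot => rfl
  | and _ _ h₁ h₂ | or _ _ h₁ h₂ | imp _ _ h₁ h₂ => simp only [Fml.rename, h₁, h₂]
  | all _ h | ex _ h => simp only [Fml.rename, h, lift_comp]

theorem Fml.rename_id {n : ℕ} (φ : Fml n) : φ.rename id = φ := by
  induction φ with
  | mem | eq | bot => rfl
  | and _ _ h₁ h₂ | or _ _ h₁ h₂ | imp _ _ h₁ h₂ => simp only [Fml.rename, h₁, h₂]
  | all _ h | ex _ h => simp only [Fml.rename, h, lift_id]

theorem Fml.shift_rename {n m : ℕ} (ρ : Fin n → Fin m) (φ : Fml n) :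
    (φ.rename ρ).shift = φ.shift.rename (lift ρ) := by
  simp only [Fml.shift, Fml.rename_rename]; rfl

theorem Fml.rename_inst {n m : ℕ} (ρ : Fin n → Fin m) (φ : Fml (n + 1)) (x : Fin n) :
    (φ.rename (inst x)).rename ρ = (φ.rename (lift ρ)).rename (inst (ρ x)) := by
  simp only [Fml.rename_rename, comp_inst]

theorem Fml.StratifiedBy.rename {n m : ℕ} {φ : Fml n} {ρ : Fin n → Fin m} {t : Fin n → ℕ}
    {s : Fin m → ℕ} (h : φ.StratifiedBy t) (hs : s ∘ ρ = t) : (φ.rename ρ).StratifiedBy s := by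
  induction φ generalizing m with
  | mem | eq => subst hs; exact h
  | bot => trivial
  | and _ _ h₁ h₂ | or _ _ h₁ h₂ | imp _ _ h₁ h₂ => exact ⟨h₁ h.1 hs, h₂ h.2 hs⟩
  | all _ ih | ex _ ih =>
    obtain ⟨k, hk⟩ := h
    refine ⟨k, ih hk ?_⟩
    funext i; refine Fin.cases rfl (fun i => congrFun hs i) i

theorem Fml.Stratified.rename {n m : ℕ} {φ : Fml n} {ρ : Fin n → Fin m} (h : φ.Stratified)
    (hρ : ρ.Injective) : (φ.rename ρ).Stratified := by
  obtain ⟨t, ht⟩ := h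
  exact ⟨Function.extend ρ t 0, ht.rename (funext fun i => hρ.extend_apply t 0 i)⟩

/-- Identifying variables can destroy stratification (`x ∈ y` becomes `x ∈ x`), so an instance of
comprehension need not be an axiom after a renaming that is not injective. It is still a theorem:
generalize over all variables, then instantiate them as desired. -/
theorem Proves.of_rename_injective {n : ℕ} {θ : Fml n}
    (h : ∀ {m : ℕ} (ρ : Fin n → Fin m) (Γ : List (Fml m)), ρ.Injective → Proves Γ (θ.rename ρ))
    {m : ℕ} (ρ : Fin n → Fin m) (Γ : List (Fml m)) : Proves Γ (θ.rename ρ) := by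
  induction n with
  | zero => exact h ρ Γ (Function.injective_of_subsingleton ρ)
  | succ n ih =>
    have := ih (θ := .all θ) (fun ρ Γ hρ => .allI (h (lift ρ) _ (lift_injective hρ)))
      (ρ ∘ Fin.succ)
    have := this.allE (ρ 0)
    rw [Fml.rename_rename] at this
    convert this using 2
    funext i; refine Fin.cases rfl (fun _ => rfl) i

/-- The comprehension axiom for `φ`. -/
def comprehensionAxiom {n : ℕ} (φ : Fml (n + 1)) : Fml n :=
  .ex (.all (0 ∈ₛ 1 ⟺ₛ φ.rename (lift Fin.succ)))

theorem comprehensionAxiom_rename {n m : ℕ} (φ : Fml (n + 1)) (ρ : Fin n → Fin m) :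
    (comprehensionAxiom φ).rename ρ = comprehensionAxiom (φ.rename (lift ρ)) := by
  have : (φ.rename (lift Fin.succ)).rename (lift (lift ρ)) =
      (φ.rename (lift ρ)).rename (lift Fin.succ) := by
    simp only [Fml.rename_rename, lift_comp]; rfl
  simp only [comprehensionAxiom, Fml.rename, Fml.biimp, this]; rfl

theorem Proves.comprehensionAxiom_rename {n m : ℕ} {φ : Fml (n + 1)} (hφ : φ.Stratified)
    (ρ : Fin n → Fin m) (Γ : List (Fml m)) : Proves Γ ((comprehensionAxiom φ).rename ρ) :=
  Proves.of_rename_injective (fun ρ Γ hρ => by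
    rw [INF.comprehensionAxiom_rename]
    exact .comprehension _ (hφ.rename (lift_injective hρ))) ρ Γ

theorem map_shift_rename {n m : ℕ} (ρ : Fin n → Fin m) (Γ : List (Fml n)) :
    (Γ.map (Fml.rename ρ)).map Fml.shift = (Γ.map Fml.shift).map (Fml.rename (lift ρ)) := by
  simp [Fml.shift_rename]

/-- Derivations are closed under substitution of variables and weakening. -/
theorem Proves.rename {n m : ℕ} {Γ : List (Fml n)} {φ : Fml n} (h : Proves Γ φ)
    (ρ : Fin n → Fin m) {Δ : List (Fml m)} (hΔ : Γ.map (Fml.rename ρ) ⊆ Δ) :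
    Proves Δ (φ.rename ρ) := by
  induction h generalizing m with
  | hyp h => exact .hyp (hΔ (List.mem_map_of_mem h))
  | botE _ ih => exact .botE (ih ρ hΔ)
  | andI _ _ ih₁ ih₂ => exact .andI (ih₁ ρ hΔ) (ih₂ ρ hΔ)
  | andE₁ _ ih => exact .andE₁ (ih ρ hΔ)
  | andE₂ _ ih => exact .andE₂ (ih ρ hΔ)
  | orI₁ _ ih => exact .orI₁ (ih ρ hΔ)
  | orI₂ _ ih => exact .orI₂ (ih ρ hΔ)
  | orE _ _ _ ih ih₁ ih₂ =>
    exact .orE (ih ρ hΔ) (ih₁ ρ (List.cons_subset_cons _ hΔ)) (ih₂ ρ (List.cons_subset_cons _ hΔ))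
  | impI _ ih => exact .impI (ih ρ (List.cons_subset_cons _ hΔ))
  | impE _ _ ih₁ ih₂ => exact .impE (ih₁ ρ hΔ) (ih₂ ρ hΔ)
  | allI _ ih =>
    refine .allI (ih (lift ρ) ?_)
    rw [← map_shift_rename]; exact List.map_subset _ hΔ
  | allE x _ ih => rw [Fml.rename_inst]; exact .allE (ρ x) (ih ρ hΔ)
  | exI x _ ih => exact .exI (ρ x) (by rw [← Fml.rename_inst]; exact ih ρ hΔ)
  | exE _ _ ih₁ ih₂ =>
    refine .exE (ih₁ ρ hΔ) ?_
    rw [Fml.shift_rename]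
    refine ih₂ (lift ρ) ?_
    rw [List.map_cons, ← map_shift_rename]
    exact List.cons_subset_cons _ (List.map_subset _ hΔ)
  | eqI x => exact .eqI _
  | eqE φ _ _ ih₁ ih₂ =>
    rw [Fml.rename_inst]
    exact .eqE _ (ih₁ ρ hΔ) (by rw [← Fml.rename_inst]; exact ih₂ ρ hΔ)
  | extensionality x y => exact .extensionality (ρ x) (ρ y)
  | comprehension φ hφ => exact Proves.comprehensionAxiom_rename hφ ρ Δ

theorem Proves.weaken {n : ℕ} {Γ Δ : List (Fml n)} {φ : Fml n} (h : Proves Γ φ) (hΔ : Γ ⊆ Δ) :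
    Proves Δ φ := by
  have := h.rename id (Δ := Δ) (by
    rw [show (Fml.rename id : Fml n → Fml n) = id from funext Fml.rename_id]; simpa using hΔ)
  rwa [Fml.rename_id] at this

end Renaming

/-! ### Henkin construction of prime theories with witnesses -/

section Henkin

/-- A numbering of formulas. -/
def Fml.code : {n : ℕ} → Fml n → ℕ
  | _, .mem x y => Nat.pair 0 (Nat.pair x y)
  | _, .eq x y => Nat.pair 1 (Nat.pair x y)
  | _, .bot => Nat.pair 2 0
  | _, .and φ ψ => Nat.pair 3 (Nat.pair φ.code ψ.code)
  | _, .or φ ψ => Nat.pair 4 (Nat.pair φ.code ψ.code)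
  | _, .imp φ ψ => Nat.pair 5 (Nat.pair φ.code ψ.code)
  | _, .all φ => Nat.pair 6 φ.code
  | _, .ex φ => Nat.pair 7 φ.code

theorem Fml.code_injective {n : ℕ} (φ ψ : Fml n) (h : φ.code = ψ.code) : φ = ψ := by
  induction φ with
  | mem | eq | bot =>
    cases ψ <;> simp_all [Fml.code, Nat.pair_eq_pair, Fin.val_inj]
  | and _ _ h₁ h₂ | or _ _ h₁ h₂ | imp _ _ h₁ h₂ =>
    cases ψ <;> simp only [Fml.code, Nat.pair_eq_pair] at h <;> first
      | (exact absurd h.1 (by decide))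
      | (rw [h₁ _ h.2.1, h₂ _ h.2.2])
  | all _ ih | ex _ ih =>
    cases ψ <;> simp only [Fml.code, Nat.pair_eq_pair] at h <;> first
      | (exact absurd h.1 (by decide))
      | (rw [ih _ h.2])

/-- Countability lets `exists_world` treat all formulas in one sequence of steps. -/
instance {n : ℕ} : Countable (Fml n) :=
  Function.Injective.countable (f := Fml.code) fun φ ψ h => φ.code_injective ψ h

/-- A formula with natural numbers as constants in place of its free variables. -/
structure CFml where
  n : ℕ
  fml : Fml n
  val : Fin n → ℕ

instance : Countable CFml :=
  Function.Injective.countable (β := Σ n, Fml n × (Fin n → ℕ))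
    (f := fun a => ⟨a.n, a.fml, a.val⟩) (by
      rintro ⟨n, φ, v⟩ ⟨m, ψ, u⟩ h
      obtain ⟨rfl, h⟩ := Sigma.mk.inj h
      obtain ⟨rfl, rfl⟩ := Prod.mk.inj (eq_of_heq h)
      rfl)

instance : Nonempty CFml := ⟨⟨0, .bot, Fin.elim0⟩⟩

namespace CFml

/-- The constants `0, …, k` as variables. -/
def index (k c : ℕ) : Fin (k + 1) := Fin.ofNat (k + 1) c

/-- The formula with the constants `0, …, k` read as variables. -/
def close (a : CFml) (k : ℕ) : Fml (k + 1) := a.fml.rename (index k ∘ a.val)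

/-- The constant `c` does not occur. -/
def Fresh (c : ℕ) (a : CFml) : Prop := ∀ i, a.val i ≠ c

/-- An upper bound for the constants. -/
def bound (a : CFml) : ℕ := Finset.univ.sup a.val

theorem val_le_bound (a : CFml) (i : Fin a.n) : a.val i ≤ a.bound :=
  Finset.le_sup (f := a.val) (Finset.mem_univ i)

theorem index_val {k c : ℕ} (h : c ≤ k) : (index k c : ℕ) = c :=
  Nat.mod_eq_of_lt (Nat.lt_succ_of_le h)

end CFml

open CFml

/-- The schematic formula `A` is derivable from finitely many members of `S`. -/
def Derives (S : Set CFml) (A : (k : ℕ) → Fml (k + 1)) : Prop :=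
  -- `index k` reduces constants modulo `k + 1`, so small `k` may confuse different constants; only
  -- large `k` count.
  ∃ l : List CFml, (∀ b ∈ l, b ∈ S) ∧ ∃ K, ∀ k ≥ K, Proves (l.map (close · k)) (A k)

variable {S S' : Set CFml} {A B : (k : ℕ) → Fml (k + 1)}

theorem Derives.mono (h : Derives S A) (hS : S ⊆ S') : Derives S' A := by
  obtain ⟨l, hl, K, hK⟩ := h
  exact ⟨l, fun b hb => hS (hl b hb), K, hK⟩

theorem Derives.hyp {a : CFml} (h : a ∈ S) : Derives S a.close :=
  ⟨[a], by simpa using h, 0, fun k _ => .hyp (by simp)⟩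

theorem Derives.map (h : Derives S A)
    (hAB : ∀ (k : ℕ) (Γ : List (Fml (k + 1))), Proves Γ (A k) → Proves Γ (B k)) :
    Derives S B := by
  obtain ⟨l, hl, K, hK⟩ := h
  exact ⟨l, hl, K, fun k hk => hAB k _ (hK k hk)⟩

theorem Derives.impE (h : Derives S fun k => A k ⟹ B k) (h' : Derives S A) : Derives S B := by
  obtain ⟨l, hl, K, hK⟩ := h
  obtain ⟨l', hl', K', hK'⟩ := h'
  refine ⟨l ++ l', fun b hb => (List.mem_append.1 hb).elim (hl b) (hl' b), max K K',
    fun k hk => .impE ((hK k (le_of_max_le_left hk)).weaken ?_)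
      ((hK' k (le_of_max_le_right hk)).weaken ?_)⟩ <;> simp

theorem Derives.impI {b : CFml} (h : Derives (insert b S) A) :
    Derives S fun k => b.close k ⟹ A k := by
  classical
  obtain ⟨l, hl, K, hK⟩ := h
  refine ⟨l.filter (· ≠ b), fun a ha => ?_, K, fun k hk => .impI ((hK k hk).weaken fun φ hφ => ?_)⟩
  · simp only [ne_eq, decide_not, List.mem_filter, Bool.not_eq_eq_eq_not, Bool.not_true,
      decide_eq_false_iff_not] at ha
    exact (hl a ha.1).resolve_left ha.2
  · obtain ⟨a, ha, rfl⟩ := List.mem_map.1 hφ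
    by_cases hab : a = b
    · simp [hab]
    · exact List.mem_cons_of_mem _ (List.mem_map.2 ⟨a, by simp [ha, hab], rfl⟩)

theorem Derives.cut {b : CFml} (h : Derives (insert b S) A) (hb : Derives S b.close) :
    Derives S A :=
  h.impI.impE hb

theorem Derives.orE {n : ℕ} {φ ψ : Fml n} {v : Fin n → ℕ}
    (h : Derives S (close ⟨n, φ ⋎ ψ, v⟩)) (h₁ : Derives (insert ⟨n, φ, v⟩ S) A)
    (h₂ : Derives (insert ⟨n, ψ, v⟩ S) A) : Derives S A := by
  have h₃ : Derives S fun k => (close ⟨n, φ, v⟩ k ⟹ A k) ⟹ (close ⟨n, ψ, v⟩ k ⟹ A k) ⟹ A k :=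
    h.map fun k Γ h => .impI (.impI (.orE (h.weaken (by simp))
      (.impE (φ := close ⟨n, φ, v⟩ k) (.hyp (by simp)) (.hyp (by simp [close])))
      (.impE (φ := close ⟨n, ψ, v⟩ k) (.hyp (by simp)) (.hyp (by simp [close])))))
  exact (h₃.impE h₁.impI).impE h₂.impI

/-- The renaming that makes the constant `c` a new variable. -/
def abstractConst (c k : ℕ) (j : Fin (k + 1)) : Fin (k + 2) := if (j : ℕ) = c then 0 else j.succ

/-- Abstracting a constant that does not occur only shifts the formula. This turns fresh constants
into eigenvariables for the quantifier rules. -/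
theorem CFml.Fresh.rename_close {c : ℕ} {a : CFml} (h : a.Fresh c) {k : ℕ} (hk : a.bound ≤ k) :
    (a.close k).rename (abstractConst c k) = (a.close k).shift := by
  simp only [close, Fml.shift, Fml.rename_rename]
  congr 1
  funext i
  simp [abstractConst, index_val ((a.val_le_bound i).trans hk), h i]

theorem rename_close_cons {n : ℕ} (φ : Fml (n + 1)) {v : Fin n → ℕ} {c k : ℕ} (hc : c ≤ k)
    (hv : ∀ i, v i ≤ k) (h : ∀ i, v i ≠ c) :
    (close ⟨n + 1, φ, Fin.cons c v⟩ k).rename (abstractConst c k) =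
      φ.rename (lift (index k ∘ v)) := by
  simp only [close, Fml.rename_rename]
  congr 1
  funext i
  refine Fin.cases ?_ (fun i => ?_) i
  · simp [abstractConst, index_val hc]
  · simp [abstractConst, index_val (hv i), h i]

theorem exists_bound (l : List CFml) : ∃ K, ∀ a ∈ l, a.bound ≤ K := by
  induction l with
  | nil => exact ⟨0, by simp⟩
  | cons a l ih =>
    obtain ⟨K, hK⟩ := ih
    refine ⟨max a.bound K, fun b hb => ?_⟩
    rcases List.mem_cons.1 hb with rfl | hb
    · exact le_max_left _ _
    · exact le_max_of_le_right (hK b hb)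

theorem rename_close_list {c : ℕ} {l : List CFml} (h : ∀ b ∈ l, b.Fresh c) {k : ℕ}
    (hk : ∀ b ∈ l, b.bound ≤ k) :
    (l.map (close · k)).map (Fml.rename (abstractConst c k)) =
      (l.map (close · k)).map Fml.shift := by
  simp only [List.map_map]
  exact List.map_congr_left fun b hb => (h b hb).rename_close (hk b hb)

/-- Since `c` occurs neither in `S` nor in the conclusion, it can be abstracted into the variable
bound by the existential rule. -/
theorem Derives.exE {n : ℕ} {φ : Fml (n + 1)} {v : Fin n → ℕ} {a : CFml} {c : ℕ}
    (h : Derives S (close ⟨n, .ex φ, v⟩))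
    (h' : Derives (insert ⟨n + 1, φ, Fin.cons c v⟩ S) a.close)
    (hS : ∀ b ∈ S, b.Fresh c) (hv : ∀ i, v i ≠ c) (ha : a.Fresh c) : Derives S a.close := by
  refine Derives.impE (A := close ⟨n, .ex φ, v⟩) ?_ h
  obtain ⟨l, hl, K, hK⟩ := h'.impI
  obtain ⟨K', hK'⟩ := exists_bound l
  refine ⟨l, hl, max K (max K' (max c (max (bound ⟨n, .ex φ, v⟩) a.bound))), fun k hk => ?_⟩
  simp only [ge_iff_le, max_le_iff] at hk
  have h₁ := (hK k hk.1).rename (abstractConst c k) (List.Subset.refl _)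
  rw [rename_close_list (fun b hb => hS b (hl b hb)) (fun b hb => (hK' b hb).trans hk.2.1),
    Fml.rename, rename_close_cons φ hk.2.2.1
      (fun i => (val_le_bound ⟨n, .ex φ, v⟩ i).trans hk.2.2.2.1) hv,
    ha.rename_close hk.2.2.2.2] at h₁
  refine .impI (.exE (φ := φ.rename (lift (index k ∘ v))) (.hyp List.mem_cons_self)
    (.impE (h₁.weaken ?_) (.hyp List.mem_cons_self)))
  exact fun _ h => List.mem_cons_of_mem _ (by rw [List.map_cons]; exact List.mem_cons_of_mem _ h)

theorem Derives.allI {n : ℕ} {φ : Fml (n + 1)} {v : Fin n → ℕ} {c : ℕ}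
    (h : Derives S (close ⟨n + 1, φ, Fin.cons c v⟩))
    (hS : ∀ b ∈ S, b.Fresh c) (hv : ∀ i, v i ≠ c) : Derives S (close ⟨n, .all φ, v⟩) := by
  obtain ⟨l, hl, K, hK⟩ := h
  obtain ⟨K', hK'⟩ := exists_bound l
  refine ⟨l, hl, max K (max K' (max c (bound ⟨n, .all φ, v⟩))), fun k hk => ?_⟩
  simp only [ge_iff_le, max_le_iff] at hk
  have h₁ := (hK k hk.1).rename (abstractConst c k) (List.Subset.refl _)
  rw [rename_close_list (fun b hb => hS b (hl b hb)) (fun b hb => (hK' b hb).trans hk.2.1),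
    rename_close_cons φ hk.2.2.1
      (fun i => (val_le_bound ⟨n, .all φ, v⟩ i).trans hk.2.2.2) hv] at h₁
  exact .allI h₁

/-- The constants that occur in no member of `S`. -/
def freshFor (S : Set CFml) : Set ℕ := {c | ∀ b ∈ S, b.Fresh c}

theorem freshFor_insert (a : CFml) (S : Set CFml) :
    freshFor (insert a S) = freshFor S \ Set.range a.val := by
  ext c
  simp only [freshFor, Set.mem_insert_iff, forall_eq_or_imp, Fresh, Set.mem_ofPred_eq,
    Set.mem_sdiff, Set.mem_range, not_exists]
  tauto

/-- One formula uses up only finitely many constants, so the supply of witnesses never runs out. -/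
theorem infinite_freshFor_insert {S : Set CFml} (h : (freshFor S).Infinite) (a : CFml) :
    (freshFor (insert a S)).Infinite := by
  rw [freshFor_insert]
  exact h.sdiff (Set.finite_range _)

/-- One step in the construction of a prime theory that omits `χ`. -/
theorem exists_extension {χ : CFml} (hχ : ¬ Derives S χ.close) (hS : (freshFor S).Infinite)
    (θ : CFml) : ∃ S', S ⊆ S' ∧ (¬ Derives S' χ.close ∧ (freshFor S').Infinite) ∧
      (θ ∈ S' ∨ Derives (insert θ S) χ.close) ∧
      ∀ n φ v, θ = ⟨n, .ex φ, v⟩ → θ ∈ S' → ∃ c, ⟨n + 1, φ, Fin.cons c v⟩ ∈ S' := by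
  by_cases hθ : Derives (insert θ S) χ.close
  · refine ⟨S, subset_rfl, ⟨hχ, hS⟩, .inr hθ, fun n φ v _ h => absurd hθ ?_⟩
    rwa [Set.insert_eq_of_mem h]
  by_cases hex : ∃ n φ v, θ = ⟨n, .ex φ, v⟩
  · obtain ⟨n, φ, v, rfl⟩ := hex
    -- The witness must be fresh for `χ` as well, or existential elimination could not discharge it.
    obtain ⟨c, hc⟩ :=
      (infinite_freshFor_insert (infinite_freshFor_insert hS ⟨n, .ex φ, v⟩) χ).nonempty
    have hc' : ∀ b ∈ insert ⟨n, .ex φ, v⟩ S, b.Fresh c := fun b hb =>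
      hc b (Set.mem_insert_of_mem _ hb)
    refine ⟨insert ⟨n + 1, φ, Fin.cons c v⟩ (insert ⟨n, .ex φ, v⟩ S),
      fun _ h => .inr (.inr h), ⟨fun h => hθ ?_,
        infinite_freshFor_insert (infinite_freshFor_insert hS _) _⟩, .inl (.inr (.inl rfl)), ?_⟩
    · exact Derives.exE (.hyp (Set.mem_insert _ _)) h hc' (hc' _ (Set.mem_insert _ _))
        (hc _ (Set.mem_insert _ _))
    · rintro m ψ u ⟨⟩ _
      exact ⟨c, Set.mem_insert _ _⟩
  · exact ⟨insert θ S, Set.subset_insert _ _, ⟨hθ, infinite_freshFor_insert hS _⟩,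
      .inl (Set.mem_insert _ _), fun n φ v h => absurd ⟨n, φ, v, h⟩ hex⟩

/-- A prime theory with witnesses. -/
structure World where
  theory : Set CFml
  closed : ∀ a, Derives theory a.close → a ∈ theory
  bot : ∀ {n} (v : Fin n → ℕ), ⟨n, .bot, v⟩ ∉ theory
  or : ∀ {n} {φ ψ : Fml n} {v : Fin n → ℕ}, ⟨n, φ ⋎ ψ, v⟩ ∈ theory →
    ⟨n, φ, v⟩ ∈ theory ∨ ⟨n, ψ, v⟩ ∈ theory
  ex : ∀ {n} {φ : Fml (n + 1)} {v : Fin n → ℕ}, ⟨n, .ex φ, v⟩ ∈ theory →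
    ∃ c, ⟨n + 1, φ, Fin.cons c v⟩ ∈ theory

theorem Derives.exists_of_iUnion {S : ℕ → Set CFml} (hS : Monotone S)
    (h : Derives (⋃ i, S i) A) : ∃ i, Derives (S i) A := by
  obtain ⟨l, hl, h⟩ := h
  suffices ∃ i, ∀ b ∈ l, b ∈ S i from this.imp fun i hi => ⟨l, hi, h⟩
  clear h
  induction l with
  | nil => exact ⟨0, by simp⟩
  | cons b l ih =>
    obtain ⟨i, hi⟩ := ih fun a ha => hl a (List.mem_cons_of_mem _ ha)
    obtain ⟨j, hj⟩ := Set.mem_iUnion.1 (hl b List.mem_cons_self)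
    refine ⟨max i j, fun a ha => ?_⟩
    rcases List.mem_cons.1 ha with rfl | ha
    · exact hS (le_max_right _ _) hj
    · exact hS (le_max_left _ _) (hi a ha)

/-- Lindenbaum's argument: iterate `exists_extension` along an enumeration of all formulas. In the
union, each formula left out would derive `χ`; closure under derivability and primeness follow from
this. -/
theorem exists_world {χ : CFml} (hχ : ¬ Derives S χ.close) (hS : (freshFor S).Infinite) :
    ∃ w : World, S ⊆ w.theory ∧ χ ∉ w.theory := by
  obtain ⟨e, he⟩ := exists_surjective_nat CFml
  choose next hsub hinv hmem hwit using fun (S : {S : Set CFml // ¬ Derives S χ.close ∧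
    (freshFor S).Infinite}) θ => exists_extension S.2.1 S.2.2 θ
  let seq : ℕ → {S : Set CFml // ¬ Derives S χ.close ∧ (freshFor S).Infinite} :=
    Nat.rec ⟨S, hχ, hS⟩ fun i S => ⟨next S (e i), hinv S (e i)⟩
  have hmono : Monotone fun i => (seq i).1 := monotone_nat_of_le_succ fun i => hsub (seq i) (e i)
  let T : Set CFml := ⋃ i, (seq i).1
  have hle : ∀ i, (seq i).1 ⊆ T := fun i => Set.subset_iUnion (fun i => (seq i).1) i
  have hT : ¬ Derives T χ.close := fun h => by
    obtain ⟨i, hi⟩ := h.exists_of_iUnion hmono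
    exact (seq i).2.1 hi
  have hmax : ∀ a, a ∉ T → Derives (insert a T) χ.close := fun a ha => by
    obtain ⟨i, rfl⟩ := he a
    exact ((hmem (seq i) (e i)).resolve_left fun h => ha (hle (i + 1) h)).mono
      (Set.insert_subset_insert (hle i))
  refine ⟨⟨T, fun a ha => ?_, fun {n} v h => ?_, fun {n φ ψ v} h => ?_, fun {n φ v} h => ?_⟩,
    hle 0, fun h => hT (.hyp h)⟩
  · by_contra h
    exact hT ((hmax a h).cut ha)
  · exact hT ((Derives.hyp h).map fun k Γ h => .botE h)
  · by_contra! hn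
    exact hT ((Derives.hyp h).orE (hmax _ hn.1) (hmax _ hn.2))
  · obtain ⟨i, hi⟩ := he ⟨n, .ex φ, v⟩
    have hm : e i ∈ (seq (i + 1)).1 := (hmem (seq i) (e i)).resolve_right fun hd =>
      hT ((hd.mono (Set.insert_subset_insert (hle i))).cut (hi ▸ .hyp h))
    obtain ⟨c, hc⟩ := hwit (seq i) (e i) n φ v hi hm
    exact ⟨c, hle (i + 1) hc⟩

end Henkin

/-! ### Kripke structures and forcing -/

/-- A Kripke structure: worlds with domains, and the maps between domains along which truth
persists. -/
structure KripkeFrame where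
  W : Type
  D : W → Type
  Mem : {w : W} → D w → D w → Prop
  IsHom : {w w' : W} → (D w → D w') → Prop
  isHom_id : ∀ w, IsHom (id : D w → D w)
  isHom_comp : ∀ {w w' w''} {g : D w' → D w''} {f : D w → D w'}, IsHom g → IsHom f → IsHom (g ∘ f)
  mem_map : ∀ {w w'} {f : D w → D w'} {x y : D w}, IsHom f → Mem x y → Mem (f x) (f y)

namespace KripkeFrame

variable {F : KripkeFrame}

/-- The transition maps from one world to another. -/
structure Hom (F : KripkeFrame) (w w' : F.W) where
  toFun : F.D w → F.D w'
  isHom : F.IsHom toFun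

instance {w w' : F.W} : CoeFun (F.Hom w w') fun _ => F.D w → F.D w' := ⟨Hom.toFun⟩

/-- The identity transition. -/
def Hom.id (w : F.W) : F.Hom w w := ⟨_root_.id, F.isHom_id w⟩

/-- Composition of transitions. -/
def Hom.comp {w w' w'' : F.W} (g : F.Hom w' w'') (f : F.Hom w w') : F.Hom w w'' :=
  ⟨g.toFun ∘ f.toFun, F.isHom_comp g.isHom f.isHom⟩

/-- Kripke forcing. -/
def Force (F : KripkeFrame) : {n : ℕ} → Fml n → {w : F.W} → (Fin n → F.D w) → Prop
  | _, .mem x y, _, v => F.Mem (v x) (v y)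
  | _, .eq x y, _, v => v x = v y
  | _, .bot, _, _ => False
  | _, .and φ ψ, _, v => F.Force φ v ∧ F.Force ψ v
  | _, .or φ ψ, _, v => F.Force φ v ∨ F.Force ψ v
  | _, .imp φ ψ, w, v => ∀ (w' : F.W) (f : F.Hom w w'), F.Force φ (f ∘ v) → F.Force ψ (f ∘ v)
  | _, .all φ, w, v => ∀ (w' : F.W) (f : F.Hom w w') (d : F.D w'), F.Force φ (Fin.cons d (f ∘ v))
  | _, .ex φ, w, v => ∃ d : F.D w, F.Force φ (Fin.cons d v)

theorem comp_cons {n : ℕ} {α β : Type*} (f : α → β) (d : α) (v : Fin n → α) :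
    f ∘ (Fin.cons d v : Fin (n + 1) → α) = Fin.cons (f d) (f ∘ v) := by
  funext i; refine Fin.cases rfl (fun _ => rfl) i

theorem Force.mono {n : ℕ} {φ : Fml n} {w w' : F.W} {v : Fin n → F.D w} (h : F.Force φ v)
    (f : F.Hom w w') : F.Force φ (f ∘ v) := by
  induction φ generalizing w w' with
  | mem => exact F.mem_map f.isHom h
  | eq => exact congrArg f h
  | bot => exact h
  | and _ _ h₁ h₂ => exact ⟨h₁ h.1 f, h₂ h.2 f⟩
  | or _ _ h₁ h₂ => exact h.imp (h₁ · f) (h₂ · f)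
  | imp => exact fun w'' g => h w'' (g.comp f)
  | all => exact fun w'' g => h w'' (g.comp f)
  | ex _ ih =>
    obtain ⟨d, hd⟩ := h
    exact ⟨f d, by rw [← comp_cons]; exact ih hd f⟩

theorem cons_comp_lift {n m : ℕ} {α : Type*} (d : α) (v : Fin m → α) (ρ : Fin n → Fin m) :
    (Fin.cons d v : Fin (m + 1) → α) ∘ lift ρ = Fin.cons d (v ∘ ρ) := by
  funext i; refine Fin.cases rfl (fun _ => rfl) i

theorem force_rename {n m : ℕ} {φ : Fml n} {ρ : Fin n → Fin m} {w : F.W} {v : Fin m → F.D w} :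
    F.Force (φ.rename ρ) v ↔ F.Force φ (v ∘ ρ) := by
  induction φ generalizing m w with
  | mem | eq | bot => rfl
  | and _ _ h₁ h₂ => exact and_congr h₁ h₂
  | or _ _ h₁ h₂ => exact or_congr h₁ h₂
  | imp _ _ h₁ h₂ => exact forall₂_congr fun _ f => imp_congr h₁ h₂
  | all _ ih => exact forall₃_congr fun _ f d => by rw [ih, cons_comp_lift]; rfl
  | ex _ ih => exact exists_congr fun d => by rw [ih, cons_comp_lift]

end KripkeFrame

/-! ### The canonical Kripke structure -/

open CFml

namespace World

variable (w : World)

theorem of_proves {n : ℕ} {Γ : List (Fml n)} {φ : Fml n} {v : Fin n → ℕ} (h : Proves Γ φ)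
    (hΓ : ∀ γ ∈ Γ, ⟨n, γ, v⟩ ∈ w.theory) : ⟨n, φ, v⟩ ∈ w.theory := by
  refine w.closed _ ⟨Γ.map fun γ => ⟨n, γ, v⟩, by simpa using hΓ, 0, fun k _ => h.rename _ ?_⟩
  rw [List.map_map]
  exact List.Subset.refl _

theorem rename_iff {n m : ℕ} {φ : Fml n} {ρ : Fin n → Fin m} {v : Fin m → ℕ} :
    ⟨m, φ.rename ρ, v⟩ ∈ w.theory ↔ ⟨n, φ, v ∘ ρ⟩ ∈ w.theory := by
  have : close ⟨m, φ.rename ρ, v⟩ = close ⟨n, φ, v ∘ ρ⟩ := by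
    funext k; exact Fml.rename_rename _ _ _
  exact ⟨fun h => w.closed _ (this ▸ .hyp h), fun h => w.closed _ (this ▸ .hyp h)⟩

theorem and_iff {n : ℕ} {φ ψ : Fml n} {v : Fin n → ℕ} :
    ⟨n, φ ⋏ ψ, v⟩ ∈ w.theory ↔ ⟨n, φ, v⟩ ∈ w.theory ∧ ⟨n, ψ, v⟩ ∈ w.theory :=
  ⟨fun h => ⟨w.of_proves (Γ := [φ ⋏ ψ]) (.andE₁ (ψ := ψ) (.hyp (by simp))) (by simpa using h),
    w.of_proves (Γ := [φ ⋏ ψ]) (.andE₂ (φ := φ) (.hyp (by simp))) (by simpa using h)⟩,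
   fun h => w.of_proves (Γ := [φ, ψ]) (.andI (.hyp (by simp)) (.hyp (by simp))) (by simpa using h)⟩

theorem or_iff {n : ℕ} {φ ψ : Fml n} {v : Fin n → ℕ} :
    ⟨n, φ ⋎ ψ, v⟩ ∈ w.theory ↔ ⟨n, φ, v⟩ ∈ w.theory ∨ ⟨n, ψ, v⟩ ∈ w.theory :=
  ⟨w.or, fun h => h.elim
    (fun h => w.of_proves (Γ := [φ]) (.orI₁ (.hyp (by simp))) (by simpa using h))
    (fun h => w.of_proves (Γ := [ψ]) (.orI₂ (.hyp (by simp))) (by simpa using h))⟩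

theorem ex_iff {n : ℕ} {φ : Fml (n + 1)} {v : Fin n → ℕ} :
    ⟨n, .ex φ, v⟩ ∈ w.theory ↔ ∃ c, ⟨n + 1, φ, Fin.cons c v⟩ ∈ w.theory := by
  refine ⟨w.ex, fun ⟨c, hc⟩ => ?_⟩
  have h : Proves [φ] (Fml.shift (.ex φ)) :=
    .exI 0 (.hyp (by
      rw [Fml.rename_rename, show inst 0 ∘ lift Fin.succ = id from
        funext fun i => Fin.cases rfl (fun _ => rfl) i, Fml.rename_id]; simp))
  have := w.of_proves (v := Fin.cons c v) h (by simpa using hc)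
  exact (w.rename_iff (φ := .ex φ) (ρ := Fin.succ) (v := Fin.cons c v)).1 this

/-- `w'` holds everything that `w` holds, with the constants renamed by `ρ`. -/
def Extends (w w' : World) (ρ : ℕ → ℕ) : Prop :=
  ∀ {n} {φ : Fml n} {v : Fin n → ℕ}, ⟨n, φ, v⟩ ∈ w.theory → ⟨n, φ, ρ ∘ v⟩ ∈ w'.theory

/-- The theory of `w` with its constants renamed by `c ↦ 2 * c`. -/
def doubled (w : World) : Set CFml :=
  {a | ∃ b ∈ w.theory, a = ⟨b.n, b.fml, (2 * ·) ∘ b.val⟩}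

theorem infinite_freshFor_doubled : (freshFor w.doubled).Infinite := by
  refine Set.infinite_of_injective_forall_mem (f := fun i : ℕ => 2 * i + 1)
    (fun i j h => by simpa using h) ?_
  rintro i _ ⟨b, _, rfl⟩ j
  simp only [Function.comp_apply]
  omega

/-- Halving the constants undoes the doubling, so a derivation from the doubled theory can be read
back in `w`. Passing to doubled constants therefore frees all odd ones without strengthening the
theory. -/
theorem mem_of_derives_doubled {n : ℕ} {φ : Fml n} {v : Fin n → ℕ}
    (h : Derives w.doubled (close ⟨n, φ, (2 * ·) ∘ v⟩)) : ⟨n, φ, v⟩ ∈ w.theory := by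
  obtain ⟨l, hl, K, hK⟩ := h
  obtain ⟨K', hK'⟩ := exists_bound (⟨n, φ, (2 * ·) ∘ v⟩ :: l)
  have key : ∀ b : CFml, b.bound ≤ max K K' → ∀ u : Fin b.n → ℕ, b.val = (2 * ·) ∘ u →
      (⟨_, b.close (max K K'), fun j => j / 2⟩ ∈ w.theory ↔ ⟨b.n, b.fml, u⟩ ∈ w.theory) := by
    intro b hb u hu
    rw [close, rename_iff]
    suffices (fun j : Fin (max K K' + 1) => (j : ℕ) / 2) ∘ index (max K K') ∘ b.val = u by rw [this]
    funext i
    simp only [Function.comp_apply, index_val ((b.val_le_bound i).trans hb)]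
    simp [hu]
  refine (key _ ((hK' _ List.mem_cons_self).trans (le_max_right _ _)) v rfl).1
    (w.of_proves (hK _ (le_max_left _ _)) fun γ hγ => ?_)
  obtain ⟨b, hb, rfl⟩ := List.mem_map.1 hγ
  have hbl := hl b hb
  have hbK := (hK' b (List.mem_cons_of_mem _ hb)).trans (le_max_right K K')
  obtain ⟨b', hb', rfl⟩ := hbl
  exact (key _ hbK b'.val rfl).2 hb'

theorem extends_of_doubled {w' : World} (h : w.doubled ⊆ w'.theory) : w.Extends w' (2 * ·) :=
  fun hφ => h ⟨_, hφ, rfl⟩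

/-- If `φ ⟹ ψ` is missing from `w`, then `φ` together with the doubled theory does not derive `ψ`,
and extends to a world that contains `φ` and omits `ψ`. -/
theorem imp_iff {n : ℕ} {φ ψ : Fml n} {v : Fin n → ℕ} :
    ⟨n, φ ⟹ ψ, v⟩ ∈ w.theory ↔ ∀ (w' : World) (ρ : ℕ → ℕ), w.Extends w' ρ →
      ⟨n, φ, ρ ∘ v⟩ ∈ w'.theory → ⟨n, ψ, ρ ∘ v⟩ ∈ w'.theory := by
  refine ⟨fun h w' ρ hρ hφ => w'.of_proves (Γ := [φ ⟹ ψ, φ])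
    (.impE (φ := φ) (.hyp (by simp)) (.hyp (by simp))) (by simpa using ⟨hρ h, hφ⟩), fun h => ?_⟩
  by_contra hn
  obtain ⟨w', hw', hχ⟩ := exists_world (S := insert ⟨n, φ, (2 * ·) ∘ v⟩ w.doubled)
    (χ := ⟨n, ψ, (2 * ·) ∘ v⟩) (fun hd => hn (w.mem_of_derives_doubled hd.impI))
    (infinite_freshFor_insert w.infinite_freshFor_doubled _)
  exact hχ (h w' (2 * ·) (w.extends_of_doubled ((Set.subset_insert _ _).trans hw'))
    (hw' (Set.mem_insert _ _)))

theorem all_iff {n : ℕ} {φ : Fml (n + 1)} {v : Fin n → ℕ} :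
    ⟨n, .all φ, v⟩ ∈ w.theory ↔ ∀ (w' : World) (ρ : ℕ → ℕ), w.Extends w' ρ →
      ∀ c, ⟨n + 1, φ, Fin.cons c (ρ ∘ v)⟩ ∈ w'.theory := by
  constructor
  · intro h w' ρ hρ c
    have hp : Proves [Fml.shift (.all φ)] φ := by
      have := Proves.allE (Γ := [Fml.shift (.all φ)]) (φ := φ.rename (lift Fin.succ)) 0
        (.hyp (by simp [Fml.shift, Fml.rename]))
      rwa [Fml.rename_rename, show inst 0 ∘ lift Fin.succ = id from
        funext fun i => Fin.cases rfl (fun _ => rfl) i, Fml.rename_id] at this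
    refine w'.of_proves hp ?_
    simpa [Fml.shift, rename_iff] using hρ h
  · intro h
    by_contra hn
    -- The constant `1` is odd, hence fresh for the doubled theory, and stands for a generic
    -- element.
    obtain ⟨w', hw', hχ⟩ := exists_world (S := w.doubled)
      (χ := ⟨n + 1, φ, Fin.cons 1 ((2 * ·) ∘ v)⟩)
      (fun hd => hn (w.mem_of_derives_doubled (hd.allI
        (by rintro _ ⟨b, _, rfl⟩ i; simp only [Function.comp_apply]; omega)
        (fun i => by simp only [Function.comp_apply]; omega))))
      w.infinite_freshFor_doubled
    exact hχ (h w' (2 * ·) (w.extends_of_doubled hw') 1)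

/-- Equality of constants in the theory `w`. -/
def Eqv (a b : ℕ) : Prop := ⟨2, 0 =ₛ 1, ![a, b]⟩ ∈ w.theory

variable {w}

theorem eqv_iff {n : ℕ} {x y : Fin n} {v : Fin n → ℕ} :
    ⟨n, x =ₛ y, v⟩ ∈ w.theory ↔ w.Eqv (v x) (v y) := by
  have := w.rename_iff (φ := 0 =ₛ 1) (ρ := ![x, y]) (v := v)
  rw [show v ∘ ![x, y] = ![v x, v y] from by funext i; fin_cases i <;> rfl] at this
  exact this

theorem Eqv.subst {n : ℕ} (φ : Fml (n + 1)) {a b : ℕ} {v : Fin n → ℕ} (h : w.Eqv a b)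
    (hφ : ⟨n + 1, φ, Fin.cons a v⟩ ∈ w.theory) : ⟨n + 1, φ, Fin.cons b v⟩ ∈ w.theory := by
  -- Variables `0` and `1` will hold `a` and `b`; `ρ x` puts `x` for the distinguished variable and
  -- moves the parameters past both.
  let ρ (x : Fin (n + 2)) : Fin (n + 1) → Fin (n + 2) := Fin.cases x fun i => i.succ.succ
  have hr (x : Fin (n + 2)) : (φ.rename (lift (fun i => i.succ.succ))).rename (inst x) =
      φ.rename (ρ x) := by
    rw [Fml.rename_rename]; congr 1; funext i; refine Fin.cases rfl (fun _ => rfl) i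
  have hp : Proves [0 =ₛ 1, φ.rename (ρ 0)] (φ.rename (ρ 1)) := by
    rw [← hr 1]
    refine .eqE _ (.hyp List.mem_cons_self) (.hyp ?_)
    rw [hr 0]; simp
  have h₀ : (Fin.cons a (Fin.cons b v) : Fin (n + 2) → ℕ) ∘ ρ 0 = Fin.cons a v := by
    funext i; refine Fin.cases rfl (fun _ => rfl) i
  have h₁ : (Fin.cons a (Fin.cons b v) : Fin (n + 2) → ℕ) ∘ ρ 1 = Fin.cons b v := by
    funext i; refine Fin.cases rfl (fun _ => rfl) i
  have := w.of_proves (v := Fin.cons a (Fin.cons b v)) hp (by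
    simp only [List.mem_cons, List.not_mem_nil, or_false, forall_eq_or_imp, forall_eq, rename_iff,
      h₀, eqv_iff]
    exact ⟨h, hφ⟩)
  rwa [rename_iff, h₁] at this

theorem Eqv.refl (a : ℕ) : w.Eqv a a := eqv_iff (x := 0) (y := 0) (v := ![a]).1
  (w.of_proves (Γ := []) (.eqI _) (by simp))

theorem Eqv.symm {a b : ℕ} (h : w.Eqv a b) : w.Eqv b a :=
  h.subst (v := ![a]) (0 =ₛ 1) (Eqv.refl a)

theorem Eqv.trans {a b c : ℕ} (h : w.Eqv a b) (h' : w.Eqv b c) : w.Eqv a c :=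
  h.symm.subst (v := ![c]) (0 =ₛ 1) h'

/-- Constants up to provable equality. -/
def setoid (w : World) : Setoid ℕ := ⟨w.Eqv, Eqv.refl, Eqv.symm, Eqv.trans⟩

/-- Membership of constants in the theory `w`. -/
def MemC (w : World) (a b : ℕ) : Prop := ⟨2, 0 ∈ₛ 1, ![a, b]⟩ ∈ w.theory

theorem memC_iff {n : ℕ} {x y : Fin n} {v : Fin n → ℕ} :
    ⟨n, x ∈ₛ y, v⟩ ∈ w.theory ↔ w.MemC (v x) (v y) := by
  have := w.rename_iff (φ := 0 ∈ₛ 1) (ρ := ![x, y]) (v := v)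
  rw [show v ∘ ![x, y] = ![v x, v y] from by funext i; fin_cases i <;> rfl] at this
  exact this

theorem MemC.congr {a a' b b' : ℕ} (ha : w.Eqv a a') (hb : w.Eqv b b') (h : w.MemC a b) :
    w.MemC a' b' := by
  have h₁ : w.MemC a' b := ha.subst (v := ![b]) (0 ∈ₛ 1) h
  have h₂ := hb.subst (v := ![a']) (1 ∈ₛ 0) (memC_iff.2 h₁)
  exact memC_iff.1 h₂

end World

/-- The Kripke structure of all prime theories. -/
abbrev canonicalFrame : KripkeFrame where
  W := World
  D w := Quotient w.setoid
  Mem {w} := Quotient.lift₂ w.MemC fun _ _ _ _ ha hb =>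
    propext ⟨.congr ha hb, .congr (World.Eqv.symm ha) (World.Eqv.symm hb)⟩
  IsHom {w w'} f := ∃ ρ : ℕ → ℕ, w.Extends w' ρ ∧ ∀ a, f (Quotient.mk _ a) = Quotient.mk _ (ρ a)
  isHom_id w := ⟨id, fun h => h, fun _ => rfl⟩
  isHom_comp := by
    rintro _ _ _ g f ⟨σ, hσ, hg⟩ ⟨ρ, hρ, hf⟩
    exact ⟨σ ∘ ρ, fun h => hσ (hρ h), fun a => by simp [hf, hg]⟩
  mem_map := by
    rintro w w' f x y ⟨ρ, hρ, hf⟩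
    refine Quotient.inductionOn₂ x y fun a b h => ?_
    rw [hf, hf]
    exact World.memC_iff (x := 0) (y := 1) (v := ρ ∘ ![a, b]).1 (hρ h)

/-- The element of the domain named by a constant. -/
def World.elem (w : World) (a : ℕ) : canonicalFrame.D w := Quotient.mk w.setoid a

theorem World.elem_surjective (w : World) : Function.Surjective w.elem := Quotient.exists_rep

theorem World.elem_eq_iff {w : World} {a b : ℕ} : w.elem a = w.elem b ↔ w.Eqv a b := Quotient.eq

theorem World.Extends.exists_hom {w w' : World} {ρ : ℕ → ℕ} (hρ : w.Extends w' ρ) :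
    ∃ f : canonicalFrame.Hom w w', f.toFun ∘ w.elem = w'.elem ∘ ρ :=
  ⟨⟨Quotient.map ρ fun a b h =>
    World.eqv_iff (x := 0) (y := 1) (v := ρ ∘ ![a, b]).1 (hρ h), ρ, hρ, fun _ => rfl⟩, rfl⟩

theorem exists_extends {w w' : World} (f : canonicalFrame.Hom w w') :
    ∃ ρ, w.Extends w' ρ ∧ f.toFun ∘ w.elem = w'.elem ∘ ρ := by
  obtain ⟨f, ρ, hρ, hf⟩ := f
  exact ⟨ρ, hρ, funext hf⟩

/-- The truth lemma. For implication and the universal quantifier, renamings along which one theory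
extends another correspond to transition maps of the quotients, in both directions. -/
theorem force_canonicalFrame {n : ℕ} (φ : Fml n) (w : World) (v : Fin n → ℕ) :
    canonicalFrame.Force φ (w.elem ∘ v) ↔ ⟨n, φ, v⟩ ∈ w.theory := by
  induction φ generalizing w with
  | mem => exact World.memC_iff.symm
  | eq => exact World.elem_eq_iff.trans World.eqv_iff.symm
  | bot => exact iff_of_false id (w.bot v)
  | and _ _ h₁ h₂ => exact (and_congr (h₁ w v) (h₂ w v)).trans w.and_iff.symm
  | or _ _ h₁ h₂ => exact (or_congr (h₁ w v) (h₂ w v)).trans w.or_iff.symm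
  | imp φ ψ h₁ h₂ =>
    rw [w.imp_iff]
    constructor
    · intro h w' ρ hρ
      obtain ⟨f, hf⟩ := hρ.exists_hom
      have := h w' f
      rwa [← Function.comp_assoc, hf, Function.comp_assoc, h₁, h₂] at this
    · intro h w' f
      obtain ⟨ρ, hρ, hf⟩ := exists_extends f
      rw [← Function.comp_assoc, hf, Function.comp_assoc, h₁, h₂]
      exact h w' ρ hρ
  | all φ ih =>
    rw [w.all_iff]
    constructor
    · intro h w' ρ hρ c
      obtain ⟨f, hf⟩ := hρ.exists_hom
      have := h w' f (w'.elem c)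
      rwa [← Function.comp_assoc, hf, Function.comp_assoc, ← KripkeFrame.comp_cons, ih] at this
    · intro h w' f d
      obtain ⟨ρ, hρ, hf⟩ := exists_extends f
      obtain ⟨c, rfl⟩ := World.elem_surjective w' d
      rw [← Function.comp_assoc, hf, Function.comp_assoc, ← KripkeFrame.comp_cons, ih]
      exact h w' ρ hρ c
  | ex φ ih =>
    rw [w.ex_iff]
    refine w.elem_surjective.exists.trans (exists_congr fun c => ?_)
    rw [← KripkeFrame.comp_cons, ih]

/-! ### Kripke models of INF and completeness -/

/-- A Kripke model of INF. -/
structure KripkeModel extends KripkeFrame where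
  extensionality : ∀ {w : W} {n : ℕ} (x y : Fin n) (v : Fin n → D w),
    toKripkeFrame.Force (.all (0 ∈ₛ x.succ ⟺ₛ 0 ∈ₛ y.succ) ⟹ x =ₛ y) v
  comprehension : ∀ {w : W} {n : ℕ} (φ : Fml (n + 1)), φ.Stratified → ∀ v : Fin n → D w,
    toKripkeFrame.Force (comprehensionAxiom φ) v

theorem force_canonicalFrame_of_proves {n : ℕ} {φ : Fml n} (h : Proves [] φ) {w : World}
    (v : Fin n → canonicalFrame.D w) : canonicalFrame.Force φ v := by
  obtain ⟨u, rfl⟩ : ∃ u, w.elem ∘ u = v := w.elem_surjective.comp_left v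
  exact (force_canonicalFrame φ w u).2 (w.of_proves h (by simp))

/-- The canonical model of INF. -/
def canonicalModel : KripkeModel where
  toKripkeFrame := canonicalFrame
  extensionality x y v := force_canonicalFrame_of_proves (.extensionality x y) v
  comprehension φ hφ v := force_canonicalFrame_of_proves (.comprehension φ hφ) v

/-- Completeness: what holds in all Kripke models of INF is provable in INF. -/
theorem proves_of_force {φ : Fml 0}
    (h : ∀ (M : KripkeModel) (w : M.W) (v : Fin 0 → M.D w), M.Force φ v) : Proves [] φ := by
  by_contra hn
  have hd : ¬ Derives ∅ (close ⟨0, φ, Fin.elim0⟩) := by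
    rintro ⟨l, hl, K, hK⟩
    obtain rfl : l = [] := List.eq_nil_iff_forall_not_mem.2 fun b hb => hl b hb
    -- All constants collapse to one variable, which is then discharged by the existence of some
    -- set, obtained from comprehension for `⊥`.
    have h₁ := (hK K le_rfl).rename (fun _ => (0 : Fin 1)) (List.Subset.refl _)
    rw [close, Fml.rename_rename, Subsingleton.elim (_ ∘ _) Fin.succ] at h₁
    exact hn (.exE (.comprehension .bot ⟨fun _ => 0, trivial⟩) (h₁.weaken (by simp)))
  obtain ⟨w, -, hw⟩ := exists_world hd (by
    rw [show freshFor ∅ = Set.univ by ext; simp [freshFor]]; exact Set.infinite_univ)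
  exact hw ((force_canonicalFrame φ w _).1 (h canonicalModel w _))

/-! ### Unfolding of forcing -/

namespace KripkeFrame

variable {F : KripkeFrame} {n : ℕ} {w : F.W} {v : Fin n → F.D w}

theorem force_mem {x y : Fin n} : F.Force (x ∈ₛ y) v ↔ F.Mem (v x) (v y) := Iff.rfl

theorem force_eq {x y : Fin n} : F.Force (x =ₛ y) v ↔ v x = v y := Iff.rfl

theorem force_and {φ ψ : Fml n} : F.Force (φ ⋏ ψ) v ↔ F.Force φ v ∧ F.Force ψ v := Iff.rfl

theorem force_or {φ ψ : Fml n} : F.Force (φ ⋎ ψ) v ↔ F.Force φ v ∨ F.Force ψ v := Iff.rfl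

theorem force_ex {φ : Fin (n + 1) → Fml (n + 1)} :
    F.Force (ex' φ) v ↔ ∃ d, F.Force (φ 0) (Fin.cons d v) := Iff.rfl

theorem force_neg {φ : Fml n} :
    F.Force φ.neg v ↔ ∀ (w' : F.W) (f : F.Hom w w'), ¬ F.Force φ (f ∘ v) := Iff.rfl

theorem force_all' {φ : Fin (n + 1) → Fml (n + 1)} :
    F.Force (all' φ) v ↔ F.Force (.all (φ 0)) v := Iff.rfl

/-- The quantifier and the implication each pass to a later world; by composition one passage is
enough. -/
theorem force_all_imp {φ ψ : Fml (n + 1)} : F.Force (.all (φ ⟹ ψ)) v ↔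
    ∀ (w' : F.W) (f : F.Hom w w') (d : F.D w'),
      F.Force φ (Fin.cons d (f ∘ v)) → F.Force ψ (Fin.cons d (f ∘ v)) := by
  refine ⟨fun h w' f d => h w' f d w' (.id w'), fun h w' f d w'' g => ?_⟩
  rw [comp_cons]
  exact h w'' (g.comp f) (g d)

theorem force_all_all_imp {φ ψ : Fml (n + 2)} : F.Force (.all (.all (φ ⟹ ψ))) v ↔
    ∀ (w' : F.W) (f : F.Hom w w') (d e : F.D w'),
      F.Force φ (Fin.cons e (Fin.cons d (f ∘ v))) →
        F.Force ψ (Fin.cons e (Fin.cons d (f ∘ v))) := by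
  refine ⟨fun h w' f d e => force_all_imp.1 (h w' f d) w' (.id w') e,
    fun h w' f d => force_all_imp.2 fun w'' g e => ?_⟩
  rw [comp_cons]
  exact h w'' (g.comp f) (g d) e

theorem force_all_all_all_imp {φ ψ : Fml (n + 3)} : F.Force (.all (.all (.all (φ ⟹ ψ)))) v ↔
    ∀ (w' : F.W) (f : F.Hom w w') (d e k : F.D w'),
      F.Force φ (Fin.cons k (Fin.cons e (Fin.cons d (f ∘ v)))) →
        F.Force ψ (Fin.cons k (Fin.cons e (Fin.cons d (f ∘ v)))) := by
  refine ⟨fun h w' f d e k => force_all_all_imp.1 (h w' f d) w' (.id w') e k,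
    fun h w' f d => force_all_all_imp.2 fun w'' g e k => ?_⟩
  rw [comp_cons]
  exact h w'' (g.comp f) (g d) e k

theorem force_all_biimp {p : Fin n} {φ : Fml (n + 1)} :
    F.Force (.all (0 ∈ₛ p.succ ⟺ₛ φ)) v ↔
    ∀ (w' : F.W) (f : F.Hom w w') (d : F.D w'),
      F.Mem d (f (v p)) ↔ F.Force φ (Fin.cons d (f ∘ v)) :=
  ⟨fun h w' f d => ⟨(h w' f d).1 w' (.id w'), (h w' f d).2 w' (.id w')⟩,
    fun h w' f d => ⟨fun w'' g => by rw [comp_cons]; exact (h w'' (g.comp f) (g d)).1,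
      fun w'' g => by rw [comp_cons]; exact (h w'' (g.comp f) (g d)).2⟩⟩

end KripkeFrame

open KripkeFrame

theorem Fml.Stratified.intro {n : ℕ} {φ : Fml n} (t : Fin n → ℕ) (h : φ.StratifiedBy t) :
    φ.Stratified := ⟨t, h⟩

/-! ### Extensionality and comprehension inside a model -/

namespace KripkeModel

variable {M : KripkeModel} {w w' : M.W} {n : ℕ}

theorem ext {x y : M.D w}
    (h : ∀ (w' : M.W) (f : M.Hom w w') (z : M.D w'), M.Mem z (f x) ↔ M.Mem z (f y)) : x = y := by
  refine M.extensionality (0 : Fin 2) 1 ![x, y] w (.id w) ?_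
  exact force_all_biimp.2 h

theorem exists_sep {φ : Fml (n + 1)} (hφ : φ.Stratified) (v : Fin n → M.D w) :
    ∃ y : M.D w, ∀ (w' : M.W) (f : M.Hom w w') (z : M.D w'),
      M.Mem z (f y) ↔ M.Force φ (Fin.cons z (f ∘ v)) := by
  obtain ⟨y, hy⟩ := M.comprehension φ hφ v
  refine ⟨y, fun w' f z => ?_⟩
  have := force_all_biimp (p := (0 : Fin (n + 1))).1 hy w' f z
  rw [force_rename, cons_comp_lift] at this
  exact this

/-- The set of all `x` with `φ(x, v)`. -/
noncomputable def sep {φ : Fml (n + 1)} (hφ : φ.Stratified) (v : Fin n → M.D w) : M.D w :=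
  (exists_sep hφ v).choose

variable {φ : Fml (n + 1)} {hφ : φ.Stratified} {v : Fin n → M.D w}

theorem mem_map_sep {f : M.Hom w w'} {z : M.D w'} :
    M.Mem z (f (sep hφ v)) ↔ M.Force φ (Fin.cons z (f ∘ v)) :=
  (exists_sep hφ v).choose_spec w' f z

theorem mem_sep {z : M.D w} : M.Mem z (sep hφ v) ↔ M.Force φ (Fin.cons z v) :=
  mem_map_sep (hφ := hφ) (f := .id w)

/-- The set is picked by choice separately at each world, but its members are prescribed at all
later worlds, so extensionality makes the choices agree along transitions. -/
theorem map_sep (f : M.Hom w w') : f (sep hφ v) = sep hφ (f ∘ v) :=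
  ext fun _ g _ =>
    (mem_map_sep (hφ := hφ) (v := v) (f := g.comp f)).trans
      (mem_map_sep (hφ := hφ) (v := f ∘ v) (f := g)).symm

/-- Turns each defining formula of the vocabulary into an equation with a concrete element of the
domain. -/
theorem force_all_biimp_iff {m : ℕ} {p : Fin m} {ψ : Fml (m + 1)} {u : Fin m → M.D w} {a : M.D w}
    (h : ∀ (w' : M.W) (f : M.Hom w w') (z : M.D w'),
      M.Mem z (f a) ↔ M.Force ψ (Fin.cons z (f ∘ u))) :
    M.Force (.all (0 ∈ₛ p.succ ⟺ₛ ψ)) u ↔ u p = a := by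
  rw [force_all_biimp]
  refine ⟨fun h' => ext fun w' f z => (h' w' f z).trans (h w' f z).symm, fun e w' f z => ?_⟩
  rw [e]; exact h w' f z

/-! ### Pairs -/

/-- `{x, y}` -/
noncomputable def upair (x y : M.D w) : M.D w :=
  sep (n := 2) (φ := 0 =ₛ 1 ⋎ 0 =ₛ 2) (.intro (fun _ => 0) ⟨rfl, rfl⟩) ![x, y]

theorem mem_upair {x y z : M.D w} : M.Mem z (upair x y) ↔ z = x ∨ z = y := mem_sep

@[simp] theorem map_upair (f : M.Hom w w') (x y : M.D w) :
    f (upair x y) = upair (f x) (f y) := by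
  rw [upair, map_sep, upair]; congr 1; funext i; fin_cases i <;> rfl

/-- `⟨x, y⟩` -/
noncomputable def pair (x y : M.D w) : M.D w := upair (upair x x) (upair x y)

@[simp] theorem map_pair (f : M.Hom w w') (x y : M.D w) : f (pair x y) = pair (f x) (f y) := by
  simp [pair]

theorem upair_left_inj {x y z : M.D w} (h : upair x y = upair x z) : y = z := by
  have hy : M.Mem y (upair x z) := h ▸ mem_upair.2 (.inr rfl)
  have hz : M.Mem z (upair x y) := h ▸ mem_upair.2 (.inr rfl)
  rcases mem_upair.1 hy with rfl | rfl
  · rcases mem_upair.1 hz with rfl | rfl <;> rfl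
  · rfl

theorem upair_self_inj {x y z : M.D w} (h : upair x x = upair y z) : x = y := by
  have : M.Mem y (upair x x) := h ▸ mem_upair.2 (.inl rfl)
  rcases mem_upair.1 this with rfl | rfl <;> rfl

@[simp] theorem pair_inj {x y a b : M.D w} : pair x y = pair a b ↔ x = a ∧ y = b := by
  refine ⟨fun h => ?_, by rintro ⟨rfl, rfl⟩; rfl⟩
  obtain rfl : x = a := by
    have : M.Mem (upair x x) (pair a b) := h ▸ mem_upair.2 (.inl rfl)
    rcases mem_upair.1 this with h | h <;> exact upair_self_inj h
  exact ⟨rfl, upair_left_inj (upair_left_inj h)⟩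

section

variable {v : Fin n → M.D w} {x y p f u z s : Fin n}

theorem force_isSingleton : M.Force (isSingleton p x) v ↔ v p = upair (v x) (v x) :=
  force_all_biimp_iff fun w' f z => by
    rw [map_upair, mem_upair, or_self]; rfl

theorem force_isUnordered : M.Force (isUnordered p x y) v ↔ v p = upair (v x) (v y) :=
  force_all_biimp_iff fun w' f z => by rw [map_upair, mem_upair]; rfl

theorem force_isPair : M.Force (isPair p x y) v ↔ v p = pair (v x) (v y) :=
  force_all_biimp_iff fun w' f z => by
    rw [pair, map_upair, mem_upair, force_or, force_isSingleton, force_isUnordered,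
      map_upair, map_upair]; rfl

theorem force_pairMem : M.Force (pairMem x y f) v ↔ M.Mem (pair (v x) (v y)) (v f) := by
  simp only [pairMem, force_ex, force_and, force_isPair, force_mem, Fin.cons_zero, Fin.cons_succ,
    exists_eq_left]

/-- `f` is single-valued -/
def Func (f : M.D w) : Prop := ∀ (w' : M.W) (g : M.Hom w w') (x y z : M.D w'),
  M.Mem (pair x y) (g f) → M.Mem (pair x z) (g f) → y = z

theorem Func.map {f : M.D w} (h : Func f) (g : M.Hom w w') : Func (g f) :=
  fun w'' g' => h w'' (g'.comp g)

theorem Func.eq {f : M.D w} (h : Func f) {x y z : M.D w} (hy : M.Mem (pair x y) f)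
    (hz : M.Mem (pair x z) f) : y = z := h w (.id w) x y z hy hz

theorem force_isFunc : M.Force (isFunc f) v ↔ Func (v f) := by
  constructor
  · intro h w' g x y z hy hz
    exact h w' g x w' (.id w') y w' (.id w') z w' (.id w') (force_pairMem.2 hy) w' (.id w')
      (force_pairMem.2 hz)
  · intro h w₁ f₁ x w₂ f₂ y w₃ f₃ z w₄ f₄ hy w₅ f₅ hz
    have := ((h.map f₁).map f₂).map f₃
    exact ((this.map f₄).map f₅).eq (force_pairMem.1 (hy.mono f₅)) (force_pairMem.1 hz)

/-- A Kuratowski pair lies two types above its components, so a relation lies three above them. A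
Church number is a relation between such relations, hence six above the objects iterated on. -/
theorem stratifiedBy_isPair {t : Fin n → ℕ} (h : t x = t y) (h' : t p = t x + 2) :
    (isPair p x y).StratifiedBy t := by
  refine ⟨t x + 1, ⟨⟨h', ?_⟩, ?_, h'⟩⟩ <;>
    simp [isSingleton, isUnordered, all', Fml.biimp, Fml.StratifiedBy, h]

theorem stratifiedBy_pairMem {t : Fin n → ℕ} (h : t x = t y) (h' : t f = t x + 3) :
    (pairMem x y f).StratifiedBy t :=
  ⟨t x + 2, stratifiedBy_isPair h rfl, h'⟩

theorem stratifiedBy_isFunc {t : Fin n → ℕ} {k : ℕ} (h : t f = k + 3) :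
    (isFunc f).StratifiedBy t :=
  ⟨k, k, k, stratifiedBy_pairMem rfl h, stratifiedBy_pairMem rfl h, rfl⟩

end

/-! ### The sets of the vocabulary -/

/-- `∃ y, ⟨x, y⟩ ∈ f ∧ u ∈ y` -/
def apBody (u f x : Fin n) : Fml n := ex' fun y => pairMem (x : Fin (n + 1)) y f ⋏ u ∈ₛ y

/-- `Ap(f, x)` -/
noncomputable def ap (f x : M.D w) : M.D w :=
  sep (n := 2) (φ := apBody 0 1 2)
    (.intro ![0, 4, 1] ⟨1, stratifiedBy_pairMem rfl rfl, rfl⟩) ![f, x]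

theorem force_apBody {v : Fin n → M.D w} {u f x : Fin n} :
    M.Force (apBody u f x) v ↔ ∃ y, M.Mem (pair (v x) y) (v f) ∧ M.Mem (v u) y := by
  simp only [apBody, force_ex, force_and, force_pairMem, force_mem, Fin.cons_zero, Fin.cons_succ]

theorem mem_ap {f x z : M.D w} :
    M.Mem z (ap f x) ↔ ∃ y, M.Mem (pair x y) f ∧ M.Mem z y := mem_sep.trans force_apBody

@[simp] theorem map_ap (f : M.Hom w w') (x y : M.D w) : f (ap x y) = ap (f x) (f y) := by
  rw [ap, map_sep, ap]; congr 1; funext i; fin_cases i <;> rfl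

theorem force_isAp {v : Fin n → M.D w} {p f x : Fin n} :
    M.Force (isAp p f x) v ↔ v p = ap (v f) (v x) :=
  force_all_biimp_iff fun w' g z => by
    rw [map_ap, mem_ap]; exact (force_apBody
      (v := Fin.cons z (g ∘ v)) (u := 0) (f := f.succ) (x := x.succ)).symm

theorem Func.ap_eq {f x y : M.D w} (hf : Func f) (h : M.Mem (pair x y) f) : ap f x = y := by
  refine ext fun w' g z => ?_
  rw [map_ap, mem_ap]
  have h' := M.mem_map g.isHom h
  rw [map_pair] at h'
  exact ⟨fun ⟨y', hy', hz⟩ => (hf.map g).eq h' hy' ▸ hz, fun hz => ⟨_, h', hz⟩⟩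

/-- The empty set. -/
noncomputable def empty : M.D w :=
  sep (n := 0) (φ := .bot) (.intro (fun _ => 0) trivial) ![]

theorem not_mem_empty {z : M.D w} : ¬ M.Mem z empty := fun h => mem_sep.1 h

@[simp] theorem map_empty (f : M.Hom w w') : f (empty : M.D w) = empty := by
  rw [empty, map_sep, empty]; congr 1; funext i; exact i.elim0

/-- `∃ x, u = ⟨x, x⟩` -/
def idBody (u : Fin n) : Fml n := ex' fun x => isPair (u : Fin (n + 1)) x x

/-- `id` -/
noncomputable def idS : M.D w :=
  sep (n := 0) (φ := idBody 0) (.intro ![2] ⟨0, stratifiedBy_isPair rfl rfl⟩) ![]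

theorem force_idBody {v : Fin n → M.D w} {u : Fin n} :
    M.Force (idBody u) v ↔ ∃ x, v u = pair x x := by
  simp only [idBody, force_ex, force_isPair, Fin.cons_zero, Fin.cons_succ]

theorem mem_idS {z : M.D w} : M.Mem z idS ↔ ∃ x, z = pair x x := mem_sep.trans force_idBody

@[simp] theorem map_idS (f : M.Hom w w') : f (idS : M.D w) = idS := by
  rw [idS, map_sep, idS]; congr 1; funext i; exact i.elim0

theorem force_isId {v : Fin n → M.D w} {i : Fin n} : M.Force (isId i) v ↔ v i = idS :=
  force_all_biimp_iff fun w' g z => by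
    rw [map_idS, mem_idS]; exact (force_idBody (v := Fin.cons z (g ∘ v)) (u := 0)).symm

theorem pair_mem_idS {x y : M.D w} : M.Mem (pair x y) idS ↔ x = y := by
  rw [mem_idS]
  constructor
  · rintro ⟨z, hz⟩
    obtain ⟨rfl, rfl⟩ := pair_inj.1 hz
    rfl
  · rintro rfl; exact ⟨x, rfl⟩

theorem func_idS : Func (idS : M.D w) := fun w' g x y z hy hz => by
  rw [map_idS, pair_mem_idS] at hy hz
  rw [← hy, ← hz]

theorem stratifiedBy_isId {t : Fin n → ℕ} {i : Fin n} {k : ℕ} (h : t i = k + 3) :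
    (isId i).StratifiedBy t :=
  ⟨k + 2, ⟨h, k, stratifiedBy_isPair rfl rfl⟩, ⟨k, stratifiedBy_isPair rfl rfl⟩, h⟩

/-- `∃ f, u = ⟨f, id⟩` -/
def zeroBody (u : Fin n) : Fml n :=
  ex' fun f => ex' fun i => isId i ⋏ isPair (u : Fin (n + 2)) f i

/-- Church zero -/
noncomputable def zeroS : M.D w :=
  sep (n := 0) (φ := zeroBody 0)
    (.intro ![5] ⟨3, 3, stratifiedBy_isId rfl, stratifiedBy_isPair rfl rfl⟩) ![]

theorem force_zeroBody {v : Fin n → M.D w} {u : Fin n} :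
    M.Force (zeroBody u) v ↔ ∃ f, v u = pair f idS := by
  simp only [zeroBody, force_ex, force_and, force_isId, force_isPair, Fin.cons_zero, Fin.cons_succ,
    exists_eq_left]

theorem mem_zeroS {z : M.D w} : M.Mem z zeroS ↔ ∃ f, z = pair f idS := mem_sep.trans force_zeroBody

@[simp] theorem map_zeroS (f : M.Hom w w') : f (zeroS : M.D w) = zeroS := by
  rw [zeroS, map_sep, zeroS]; congr 1; funext i; exact i.elim0

theorem force_isZero {v : Fin n → M.D w} {z : Fin n} : M.Force (isZero z) v ↔ v z = zeroS :=
  force_all_biimp_iff fun w' g z => by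
    rw [map_zeroS, mem_zeroS]; exact (force_zeroBody (v := Fin.cons z (g ∘ v)) (u := 0)).symm

theorem pair_mem_zeroS {f p : M.D w} : M.Mem (pair f p) zeroS ↔ p = idS := by
  rw [mem_zeroS]
  constructor
  · rintro ⟨g, hg⟩
    exact (pair_inj.1 hg).2
  · rintro rfl; exact ⟨f, rfl⟩

theorem func_zeroS : Func (zeroS : M.D w) := fun w' g x y z hy hz => by
  rw [map_zeroS, pair_mem_zeroS] at hy hz
  rw [hy, hz]

/-- `∃ x w t q, u = ⟨x, w⟩ ∧ t ∈ FUNC ∧ ⟨f, t⟩ ∈ z ∧ ⟨x, q⟩ ∈ t ∧ ⟨q, w⟩ ∈ f` -/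
def stepBody (u f z : Fin n) : Fml n :=
  ex' fun x => ex' fun w => ex' fun t => ex' fun q =>
    isPair (u : Fin (n + 4)) x w ⋏ isFunc (t : Fin (n + 4)) ⋏ pairMem (f : Fin (n + 4)) t z ⋏
      pairMem (x : Fin (n + 4)) q t ⋏ pairMem (q : Fin (n + 4)) w f

theorem stratifiedBy_stepBody {t : Fin n → ℕ} {u f z : Fin n} {k : ℕ} (hu : t u = k + 2)
    (hf : t f = k + 3) (hz : t z = k + 6) : (stepBody u f z).StratifiedBy t :=
  ⟨k, k, k + 3, k, stratifiedBy_isPair rfl hu, stratifiedBy_isFunc rfl,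
    stratifiedBy_pairMem hf (by simp only [Fin.cons_succ, hf, hz]), stratifiedBy_pairMem rfl rfl,
    stratifiedBy_pairMem rfl hf⟩

/-- `λ x, f (z f x)` -/
noncomputable def step (f z : M.D w) : M.D w :=
  sep (n := 2) (φ := stepBody 0 1 2)
    (.intro ![2, 3, 6] (stratifiedBy_stepBody rfl rfl rfl)) ![f, z]

theorem force_stepBody {v : Fin n → M.D w} {u f z : Fin n} :
    M.Force (stepBody u f z) v ↔ ∃ x y t q, v u = pair x y ∧ Func t ∧ M.Mem (pair (v f) t) (v z) ∧
      M.Mem (pair x q) t ∧ M.Mem (pair q y) (v f) := by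
  simp only [stepBody, force_ex, force_and, force_isFunc, force_isPair, force_pairMem,
    Fin.cons_zero, Fin.cons_succ]

theorem mem_step {f z u : M.D w} : M.Mem u (step f z) ↔ ∃ x y t q, u = pair x y ∧ Func t ∧
    M.Mem (pair f t) z ∧ M.Mem (pair x q) t ∧ M.Mem (pair q y) f := mem_sep.trans force_stepBody

@[simp] theorem map_step (f : M.Hom w w') (x y : M.D w) : f (step x y) = step (f x) (f y) := by
  rw [step, map_sep, step]; congr 1; funext i; fin_cases i <;> rfl

theorem force_isStep {v : Fin n → M.D w} {p f x : Fin n} :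
    M.Force (isStep p f x) v ↔ v p = step (v f) (v x) :=
  force_all_biimp_iff fun w' g z => by
    rw [map_step, mem_step]; exact (force_stepBody
      (v := Fin.cons z (g ∘ v)) (u := 0) (f := f.succ) (z := x.succ)).symm

/-- `⟨b, c⟩` belongs to a function that `u` assigns to `f`, that is `u f b = c`. -/
def It (u f b c : M.D w) : Prop :=
  ∃ t, Func t ∧ M.Mem (pair f t) u ∧ M.Mem (pair b c) t

theorem pair_mem_step {f z x y : M.D w} :
    M.Mem (pair x y) (step f z) ↔ ∃ q, It z f x q ∧ M.Mem (pair q y) f := by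
  rw [mem_step]
  constructor
  · rintro ⟨x', y', t, q, h, ht, hz, hq, hf⟩
    obtain ⟨rfl, rfl⟩ := pair_inj.1 h
    exact ⟨q, ⟨t, ht, hz, hq⟩, hf⟩
  · rintro ⟨q, ⟨t, ht, hz, hq⟩, hf⟩
    exact ⟨x, y, t, q, rfl, ht, hz, hq, hf⟩

theorem It.eq {u f b c d : M.D w} (hu : Func u) (hc : It u f b c) (hd : It u f b d) : c = d := by
  obtain ⟨t, ht, htu, htb⟩ := hc
  obtain ⟨t', -, htu', htb'⟩ := hd
  obtain rfl := hu.eq htu htu'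
  exact ht.eq htb htb'

theorem It.zeroS (f b : M.D w) : It zeroS f b b :=
  ⟨idS, func_idS, pair_mem_zeroS.2 rfl, pair_mem_idS.2 rfl⟩

theorem func_step {f z : M.D w} (hf : Func f) (hz : Func z) : Func (step f z) := by
  intro w' g x y y' hy hy'
  rw [map_step, pair_mem_step] at hy hy'
  obtain ⟨q, hq, hy⟩ := hy
  obtain ⟨q', hq', hy'⟩ := hy'
  obtain rfl := hq.eq (hz.map g) hq'
  exact (hf.map g).eq hy hy'

/-- `∃ f p, a = ⟨f, p⟩ ∧ f ∈ FUNC ∧ p = λ x, f (z f x)` -/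
def succOfBody (a z : Fin n) : Fml n :=
  ex' fun f => ex' fun p => isPair (a : Fin (n + 2)) f p ⋏ isFunc (f : Fin (n + 2)) ⋏
    isStep (p : Fin (n + 2)) f z

theorem stratifiedBy_isStep {t : Fin n → ℕ} {p f z : Fin n} {k : ℕ} (hp : t p = k + 3)
    (hf : t f = k + 3) (hz : t z = k + 6) : (isStep p f z).StratifiedBy t :=
  ⟨k + 2, ⟨hp, stratifiedBy_stepBody (k := k) rfl hf hz⟩,
    ⟨stratifiedBy_stepBody (k := k) rfl hf hz, hp⟩⟩

theorem stratifiedBy_succOfBody {t : Fin n → ℕ} {a z : Fin n} {k : ℕ} (ha : t a = k + 5)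
    (hz : t z = k + 6) : (succOfBody a z).StratifiedBy t :=
  ⟨k + 3, k + 3, stratifiedBy_isPair rfl ha, stratifiedBy_isFunc rfl,
    stratifiedBy_isStep rfl rfl hz⟩

/-- The successor of the Church number `z` -/
noncomputable def succOf (z : M.D w) : M.D w :=
  sep (n := 1) (φ := succOfBody 0 1) (.intro ![5, 6] (stratifiedBy_succOfBody rfl rfl)) ![z]

theorem force_succOfBody {v : Fin n → M.D w} {a z : Fin n} :
    M.Force (succOfBody a z) v ↔ ∃ f, v a = pair f (step f (v z)) ∧ Func f := by
  simp only [succOfBody, force_ex, force_and, force_isFunc, force_isPair, force_isStep,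
    Fin.cons_zero, Fin.cons_succ]
  refine exists_congr fun f => ⟨?_, fun h => ⟨_, h.1, h.2, rfl⟩⟩
  rintro ⟨p, h, hf, rfl⟩
  exact ⟨h, hf⟩

theorem mem_succOf {z a : M.D w} :
    M.Mem a (succOf z) ↔ ∃ f, a = pair f (step f z) ∧ Func f := mem_sep.trans force_succOfBody

@[simp] theorem map_succOf (f : M.Hom w w') (x : M.D w) : f (succOf x) = succOf (f x) := by
  rw [succOf, map_sep, succOf]; congr 1; funext i; fin_cases i; rfl

theorem force_isSuccOf {v : Fin n → M.D w} {p x : Fin n} :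
    M.Force (isSuccOf p x) v ↔ v p = succOf (v x) :=
  force_all_biimp_iff fun w' g z => by
    rw [map_succOf, mem_succOf]; exact (force_succOfBody
      (v := Fin.cons z (g ∘ v)) (a := 0) (z := x.succ)).symm

theorem pair_mem_succOf {z f p : M.D w} :
    M.Mem (pair f p) (succOf z) ↔ p = step f z ∧ Func f := by
  rw [mem_succOf]
  constructor
  · rintro ⟨g, h, hg⟩
    obtain ⟨rfl, rfl⟩ := pair_inj.1 h
    exact ⟨rfl, hg⟩
  · rintro ⟨rfl, hf⟩; exact ⟨f, rfl, hf⟩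

theorem func_succOf (z : M.D w) : Func (succOf z) := fun w' g x y y' hy hy' => by
  rw [map_succOf, pair_mem_succOf] at hy hy'
  rw [hy.1, hy'.1]

theorem it_succOf {u f b d : M.D w} (hu : Func u) (hf : Func f) :
    It (succOf u) f b d ↔ ∃ c, It u f b c ∧ M.Mem (pair c d) f := by
  constructor
  · rintro ⟨t, -, htu, htb⟩
    obtain ⟨rfl, -⟩ := pair_mem_succOf.1 htu
    exact pair_mem_step.1 htb
  · intro h
    exact ⟨_, func_step hf hu, pair_mem_succOf.2 ⟨rfl, hf⟩, pair_mem_step.2 h⟩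

/-- Apply both to the empty function: zero yields the identity, while a successor yields a composite
with the empty function, which has no pairs. -/
theorem succOf_ne_zeroS (u : M.D w) : succOf u ≠ zeroS := fun h => by
  have h₁ : M.Mem (pair empty idS) (succOf u) := h ▸ pair_mem_zeroS.2 rfl
  have h₂ : M.Mem (pair empty empty) (step empty u) :=
    (pair_mem_succOf.1 h₁).1 ▸ pair_mem_idS.2 rfl
  obtain ⟨q, -, hq⟩ := pair_mem_step.1 h₂
  exact not_mem_empty hq

/-- `∃ z v, b = ⟨z, v⟩ ∧ z ∈ FUNC ∧ v` is the successor of `z` -/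
def succBody (b : Fin n) : Fml n :=
  ex' fun z => ex' fun v => isPair (b : Fin (n + 2)) z v ⋏ isFunc (z : Fin (n + 2)) ⋏
    isSuccOf (v : Fin (n + 2)) z

theorem stratifiedBy_isSuccOf {t : Fin n → ℕ} {p z : Fin n} {k : ℕ} (hp : t p = k + 6)
    (hz : t z = k + 6) : (isSuccOf p z).StratifiedBy t :=
  ⟨k + 5, ⟨hp, stratifiedBy_succOfBody (k := k) rfl hz⟩,
    ⟨stratifiedBy_succOfBody (k := k) rfl hz, hp⟩⟩

/-- Church successor -/
noncomputable def succS : M.D w :=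
  sep (n := 0) (φ := succBody 0) (.intro ![8] ⟨6, 6, stratifiedBy_isPair rfl rfl,
    stratifiedBy_isFunc (k := 3) rfl, stratifiedBy_isSuccOf (k := 0) rfl rfl⟩) ![]

theorem force_succBody {v : Fin n → M.D w} {b : Fin n} :
    M.Force (succBody b) v ↔ ∃ z, v b = pair z (succOf z) ∧ Func z := by
  simp only [succBody, force_ex, force_and, force_isFunc, force_isPair, force_isSuccOf,
    Fin.cons_zero, Fin.cons_succ]
  refine exists_congr fun f => ⟨?_, fun h => ⟨_, h.1, h.2, rfl⟩⟩
  rintro ⟨p, h, hf, rfl⟩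
  exact ⟨h, hf⟩

theorem mem_succS {b : M.D w} : M.Mem b succS ↔ ∃ z, b = pair z (succOf z) ∧ Func z :=
  mem_sep.trans force_succBody

@[simp] theorem map_succS (f : M.Hom w w') : f (succS : M.D w) = succS := by
  rw [succS, map_sep, succS]; congr 1; funext i; exact i.elim0

theorem force_isSucc {v : Fin n → M.D w} {s : Fin n} : M.Force (isSucc s) v ↔ v s = succS :=
  force_all_biimp_iff fun w' g z => by
    rw [map_succS, mem_succS]; exact (force_succBody (v := Fin.cons z (g ∘ v)) (b := 0)).symm

theorem pair_mem_succS {u d : M.D w} : M.Mem (pair u d) succS ↔ d = succOf u ∧ Func u := by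
  rw [mem_succS]
  constructor
  · rintro ⟨g, h, hg⟩
    obtain ⟨rfl, rfl⟩ := pair_inj.1 h
    exact ⟨rfl, hg⟩
  · rintro ⟨rfl, hf⟩; exact ⟨u, rfl, hf⟩

theorem func_succS : Func (succS : M.D w) := fun w' g x y y' hy hy' => by
  rw [map_succS, pair_mem_succS] at hy hy'
  rw [hy.1, hy'.1]

theorem Func.ap_succS {u : M.D w} (hu : Func u) : ap succS u = succOf u :=
  func_succS.ap_eq (pair_mem_succS.2 ⟨rfl, hu⟩)

/-- `x` belongs to all sets that contain `zero` and are closed under `u ↦ Ap(s, u)`. -/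
def natBody (x zero s : Fin n) : Fml n :=
  all' fun X => (zero ∈ₛ X ⋏
    all' fun u => u ∈ₛ X ⟹ ex' fun v => isAp (v : Fin (n + 3)) s u ⋏ v ∈ₛ X)
    ⟹ x ∈ₛ X

theorem stratifiedBy_isAp {t : Fin n → ℕ} {p f x : Fin n} {k : ℕ} (hp : t p = k + 1)
    (hx : t x = k + 1) (hf : t f = k + 4) : (isAp p f x).StratifiedBy t :=
  ⟨k, ⟨hp, k + 1, stratifiedBy_pairMem hx (by simp [hx, hf]), rfl⟩,
    ⟨k + 1, stratifiedBy_pairMem hx (by simp [hx, hf]), rfl⟩, hp⟩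

/-- The set of Church numbers -/
noncomputable def natS : M.D w :=
  sep (n := 2) (φ := natBody 0 1 2) (.intro ![6, 6, 9] ⟨7, ⟨rfl, 6, rfl, 6,
    stratifiedBy_isAp (k := 5) rfl rfl rfl, rfl⟩, rfl⟩) ![zeroS, succS]

theorem force_natBody {v : Fin n → M.D w} {x z s : Fin n} (hz : v z = zeroS) (hs : v s = succS) :
    M.Force (natBody x z s) v ↔ ∀ (w' : M.W) (f : M.Hom w w') (X : M.D w'), M.Mem zeroS X →
      (∀ (w'' : M.W) (g : M.Hom w' w'') (u : M.D w''), M.Mem u (g X) → M.Mem (ap succS u) (g X)) →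
      M.Mem (f (v x)) X := by
  simp only [natBody, force_all', force_all_imp, force_ex, force_and, force_isAp, force_mem,
    Fin.cons_zero, Fin.cons_succ, exists_eq_left, Function.comp_apply, hz, hs, map_zeroS,
    map_succS, and_imp]

theorem mem_natS {x : M.D w} :
    M.Mem x natS ↔ ∀ (w' : M.W) (f : M.Hom w w') (X : M.D w'), M.Mem zeroS X →
      (∀ (w'' : M.W) (g : M.Hom w' w'') (u : M.D w''), M.Mem u (g X) → M.Mem (ap succS u) (g X)) →
      M.Mem (f x) X :=
  mem_sep.trans (force_natBody rfl rfl)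

@[simp] theorem map_natS (f : M.Hom w w') : f (natS : M.D w) = natS := by
  rw [natS, map_sep, natS]; congr 1; funext i
  fin_cases i
  · exact map_zeroS f
  · exact map_succS f

theorem force_isLeastClosed {v : Fin n → M.D w} {N z s : Fin n} (hz : v z = zeroS)
    (hs : v s = succS) : M.Force (isLeastClosed N z s) v ↔ v N = natS :=
  force_all_biimp_iff fun w' g x => by
    rw [map_natS, mem_natS]
    exact (force_natBody (v := Fin.cons x (g ∘ v)) (x := 0) (z := z.succ) (s := s.succ)
      ((congrArg g hz).trans (map_zeroS g)) ((congrArg g hs).trans (map_succS g))).symm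

theorem force_isChurch {v : Fin n → M.D w} {z s N : Fin n} :
    M.Force (isChurch z s N) v ↔ v z = zeroS ∧ v s = succS ∧ v N = natS := by
  rw [isChurch, force_and, force_and, force_isZero, force_isSucc]
  exact and_congr_right fun hz => and_congr_right fun hs => force_isLeastClosed hz hs

/-! ### Church numbers -/

theorem zeroS_mem_natS : M.Mem (zeroS : M.D w) natS := mem_natS.2 fun w' f X h _ => by
  rwa [map_zeroS]

/-- Being single-valued is stratified, holds of zero, and holds of every `succOf u`. It is needed
because `ap succS u` is known to be `succOf u` only for `u ∈ FUNC`. -/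
theorem func_of_mem_natS {x : M.D w} (h : M.Mem x natS) : Func x := by
  obtain ⟨X, hX⟩ : ∃ X : M.D w, ∀ {w' : M.W} (f : M.Hom w w') (u : M.D w'),
      M.Mem u (f X) ↔ Func u :=
    ⟨sep (n := 0) (φ := isFunc 0) (.intro ![3] (stratifiedBy_isFunc (k := 0) rfl)) ![],
      fun f u => mem_map_sep.trans force_isFunc⟩
  refine (hX (.id w) _).1 (mem_natS.1 h w (.id w) X ((hX (.id w) _).2 func_zeroS)
    fun w' g u hu => ?_)
  have := (hX g u).1 hu
  rw [this.ap_succS]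
  exact (hX g _).2 (func_succOf u)

theorem succOf_mem_natS {x : M.D w} (h : M.Mem x natS) : M.Mem (succOf x) natS :=
  mem_natS.2 fun w' f X h0 hs => by
    have := hs w' (.id w') (f x) (mem_natS.1 h w' f X h0 hs)
    rwa [((func_of_mem_natS h).map f).ap_succS, ← map_succOf] at this

theorem pair_succOf_mem_succS {x : M.D w} (h : M.Mem x natS) :
    M.Mem (pair x (succOf x)) succS :=
  pair_mem_succS.2 ⟨rfl, func_of_mem_natS h⟩

/-- Intersecting `X` with the Church numbers lets the induction step assume that `u` is one of them.
-/
theorem natS_induction (X : M.D w) (h0 : M.Mem zeroS X)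
    (hs : ∀ (w' : M.W) (f : M.Hom w w') (u : M.D w'), M.Mem u natS → M.Mem u (f X) →
      M.Mem (succOf u) (f X)) {x : M.D w} (hx : M.Mem x natS) : M.Mem x X := by
  obtain ⟨Y, hY⟩ : ∃ Y : M.D w, ∀ {w' : M.W} (f : M.Hom w w') (u : M.D w'),
      M.Mem u (f Y) ↔ M.Mem u (f X) ∧ M.Mem u (f natS) :=
    ⟨sep (n := 2) (φ := 0 ∈ₛ 1 ⋏ 0 ∈ₛ 2) (.intro ![0, 1, 1] ⟨rfl, rfl⟩) ![X, natS],
      fun f u => mem_map_sep⟩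
  refine ((hY (.id w) _).1 (mem_natS.1 hx w (.id w) Y ((hY (.id w) _).2 ⟨h0, zeroS_mem_natS⟩)
    fun w' f u hu => ?_)).1
  obtain ⟨huX, huN⟩ := (hY f u).1 hu
  rw [map_natS] at huN
  rw [(func_of_mem_natS huN).ap_succS, hY, map_natS]
  exact ⟨hs w' f u huN huX, succOf_mem_natS huN⟩

/-- The Church counting axiom, at `w`. -/
def Counting (M : KripkeModel) (w : M.W) : Prop := ∀ (w' : M.W) (_ : M.Hom w w') (j : M.D w'),
  M.Mem j natS → ap (ap j succS) zeroS = j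

theorem Counting.map (h : M.Counting w) (f : M.Hom w w') : M.Counting w' :=
  fun w'' g => h w'' (g.comp f)

theorem Counting.eq_of_it (h : M.Counting w) {j c : M.D w} (hj : M.Mem j natS)
    (hc : It j succS zeroS c) : c = j := by
  obtain ⟨t, ht, htj, htc⟩ := hc
  have := h w (.id w) j hj
  rwa [(func_of_mem_natS hj).ap_eq htj, ht.ap_eq htc] at this

/-! ### Initial segments -/

/-- `B` is the set of all Church numbers before `x`. -/
structure Seg (B x : M.D w) : Prop where
  zero : M.Mem zeroS B ∨ zeroS = x
  not_mem : ∀ (w' : M.W) (f : M.Hom w w'), ¬ M.Mem (f x) (f B)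
  succ : ∀ (w' : M.W) (f : M.Hom w w') (u d : M.D w'), M.Mem u (f B) → M.Mem (pair u d) succS →
    M.Mem d (f B) ∨ d = f x
  pred : ∀ (w' : M.W) (f : M.Hom w w') (y : M.D w'), M.Mem y (f B) ∨ y = f x →
    y = zeroS ∨ ∃ u, M.Mem u (f B) ∧ M.Mem (pair u y) succS
  inj : ∀ (w' : M.W) (f : M.Hom w w') (u v d : M.D w'), M.Mem u (f B) → M.Mem v (f B) →
    M.Mem (pair u d) succS → M.Mem (pair v d) succS → u = v
  -- Closure is required only at `u ∈ B`, so induction reaches `x` but never asks about the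
  -- successor of `x`.
  ind : ∀ (w' : M.W) (f : M.Hom w w') (X y : M.D w'), M.Mem zeroS X →
    (∀ (w'' : M.W) (g : M.Hom w' w'') (u d : M.D w''), M.Mem u (g (f B)) → M.Mem u (g X) →
      M.Mem (pair u d) succS → M.Mem d (g X)) → M.Mem y (f B) ∨ y = f x → M.Mem y X

/-- The formula that defines `Seg`. -/
def segFml (B x z s : Fin n) : Fml n :=
  (z ∈ₛ B ⋎ z =ₛ x) ⋏
  (x ∈ₛ B).neg ⋏
  (all' fun u => all' fun d => (u ∈ₛ B ⋏ pairMem (u : Fin (n + 2)) d s) ⟹ (d ∈ₛ B ⋎ d =ₛ x)) ⋏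
  (all' fun y => (y ∈ₛ B ⋎ y =ₛ x) ⟹
    (y =ₛ z ⋎ ex' fun u => u ∈ₛ B ⋏ pairMem (u : Fin (n + 2)) y s)) ⋏
  (all' fun u => all' fun v => all' fun d =>
    (u ∈ₛ B ⋏ v ∈ₛ B ⋏ pairMem (u : Fin (n + 3)) d s ⋏ pairMem (v : Fin (n + 3)) d s) ⟹ u =ₛ v) ⋏
  (all' fun X => all' fun y =>
    (z ∈ₛ X ⋏
      (all' fun u => all' fun d => (u ∈ₛ B ⋏ u ∈ₛ X ⋏ pairMem (u : Fin (n + 4)) d s) ⟹ d ∈ₛ X) ⋏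
      (y ∈ₛ B ⋎ y =ₛ x)) ⟹ y ∈ₛ X)

/-- The definition of a segment avoids iteration altogether, so that it stratifies and can itself be
proved by induction. -/
theorem stratifiedBy_segFml {t : Fin n → ℕ} {B x z s : Fin n} {k : ℕ} (hB : t B = k + 1)
    (hx : t x = k) (hz : t z = k) (hs : t s = k + 3) : (segFml B x z s).StratifiedBy t := by
  have hp {m : ℕ} {t' : Fin m → ℕ} {u v f : Fin m} (hu : t' u = k) (hv : t' v = k)
      (hf : t' f = k + 3) : (pairMem u v f).StratifiedBy t' :=
    stratifiedBy_pairMem (hu.trans hv.symm) (hf.trans (by rw [hu]))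
  refine ⟨⟨hB.trans (by rw [hz]), hz.trans hx.symm⟩, ⟨hB.trans (by rw [hx]), trivial⟩,
    ⟨k, k, ⟨hB, hp rfl rfl hs⟩, hB, hx.symm⟩, ⟨k, ⟨hB, hx.symm⟩, hz.symm, k, hB, hp rfl rfl hs⟩,
    ⟨k, k, k, ⟨hB, hB, hp rfl rfl hs, hp rfl rfl hs⟩, rfl⟩,
    ⟨k + 1, k, ⟨congrArg (· + 1) hz.symm, ⟨k, k, ⟨hB, rfl, hp rfl rfl hs⟩, rfl⟩, hB, hx.symm⟩,
      rfl⟩⟩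

theorem force_segFml {v : Fin n → M.D w} {B x z s : Fin n} (hz : v z = zeroS) (hs : v s = succS) :
    M.Force (segFml B x z s) v ↔ Seg (v B) (v x) := by
  simp only [segFml, all', force_all_imp, force_all_all_imp, force_all_all_all_imp, force_ex,
    force_and, force_or, force_neg, force_eq, force_pairMem, force_mem, Fin.cons_zero,
    Fin.cons_succ, Function.comp_apply, hz, hs, map_zeroS, map_succS, and_imp]
  exact ⟨fun ⟨h₁, h₂, h₃, h₄, h₅, h₆⟩ => ⟨h₁, h₂, h₃, h₄, h₅, h₆⟩,
    fun ⟨h₁, h₂, h₃, h₄, h₅, h₆⟩ => ⟨h₁, h₂, h₃, h₄, h₅, h₆⟩⟩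

/-- `B ∪ {x}` -/
noncomputable def insert (B x : M.D w) : M.D w :=
  sep (n := 2) (φ := 0 ∈ₛ 1 ⋎ 0 =ₛ 2) (.intro ![0, 1, 0] ⟨rfl, rfl⟩) ![B, x]

theorem mem_insert {B x z : M.D w} : M.Mem z (insert B x) ↔ M.Mem z B ∨ z = x := mem_sep

@[simp] theorem map_insert (f : M.Hom w w') (x y : M.D w) :
    f (insert x y) = insert (f x) (f y) := by
  rw [insert, map_sep, insert]; congr 1; funext i; fin_cases i <;> rfl

/-- `∃ a b, p = ⟨a, b⟩ ∧ ((a ∈ B ∧ ⟨a, b⟩ ∈ s) ∨ (a = x ∧ b = z))` -/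
def cycleBody (p B x z s : Fin n) : Fml n :=
  ex' fun a => ex' fun b => isPair (p : Fin (n + 2)) a b ⋏
    ((a ∈ₛ B ⋏ pairMem (a : Fin (n + 2)) b s) ⋎ (a =ₛ x ⋏ b =ₛ z))

/-- The function that maps each member of `B` to its successor, and `x` to zero. -/
noncomputable def cycle (B x : M.D w) : M.D w :=
  sep (n := 4) (φ := cycleBody 0 1 2 3 4) (.intro ![8, 7, 6, 6, 9]
    ⟨6, 6, stratifiedBy_isPair rfl rfl, ⟨rfl, stratifiedBy_pairMem rfl rfl⟩, rfl, rfl⟩)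
    ![B, x, zeroS, succS]

theorem force_cycleBody {v : Fin n → M.D w} {p B x z s : Fin n} :
    M.Force (cycleBody p B x z s) v ↔ ∃ a b, v p = pair a b ∧
      ((M.Mem a (v B) ∧ M.Mem (pair a b) (v s)) ∨ (a = v x ∧ b = v z)) := by
  simp only [cycleBody, force_ex, force_and, force_or, force_isPair, force_mem, force_pairMem,
    force_eq, Fin.cons_zero, Fin.cons_succ]

theorem pair_mem_cycle {B x a b : M.D w} : M.Mem (pair a b) (cycle B x) ↔
    (M.Mem a B ∧ M.Mem (pair a b) succS) ∨ (a = x ∧ b = zeroS) := by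
  refine (mem_sep.trans force_cycleBody).trans ⟨?_, fun h => ⟨a, b, rfl, h⟩⟩
  rintro ⟨a', b', h, h'⟩
  obtain ⟨rfl, rfl⟩ := pair_inj.1 h
  exact h'

@[simp] theorem map_cycle (f : M.Hom w w') (B x : M.D w) :
    f (cycle B x) = cycle (f B) (f x) := by
  rw [cycle, map_sep, cycle]; congr 1; funext i
  fin_cases i
  · rfl
  · rfl
  · exact map_zeroS f
  · exact map_succS f

/-- `∃ t, t ∈ FUNC ∧ ⟨f, t⟩ ∈ u ∧ ⟨b, c⟩ ∈ t` -/
def itFml (u f b c : Fin n) : Fml n :=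
  ex' fun t => isFunc (t : Fin (n + 1)) ⋏ pairMem (f : Fin (n + 1)) t u ⋏
    pairMem (b : Fin (n + 1)) c t

theorem force_itFml {v : Fin n → M.D w} {u f b c : Fin n} :
    M.Force (itFml u f b c) v ↔ It (v u) (v f) (v b) (v c) := by
  simp only [itFml, force_ex, force_and, force_isFunc, force_pairMem, Fin.cons_zero, Fin.cons_succ]
  rfl

theorem stratifiedBy_itFml {t : Fin n → ℕ} {u f b c : Fin n} {k : ℕ} (hu : t u = k + 6)
    (hf : t f = k + 3) (hb : t b = k) (hc : t c = k) : (itFml u f b c).StratifiedBy t :=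
  ⟨k + 3, stratifiedBy_isFunc rfl, stratifiedBy_pairMem hf (by simp [hu, hf]),
    stratifiedBy_pairMem (by simp [hb, hc]) (by simp [hb])⟩

/-- The set of all `u` such that `u f b` and `u s b` are defined and equal -/
noncomputable def agree (f s b : M.D w) : M.D w :=
  sep (n := 3) (φ := ex' fun c => itFml (1 : Fin 5) 2 4 c ⋏ itFml (1 : Fin 5) 3 4 c)
    (.intro ![6, 3, 3, 0] ⟨0, stratifiedBy_itFml (k := 0) rfl rfl rfl rfl,
      stratifiedBy_itFml (k := 0) rfl rfl rfl rfl⟩) ![f, s, b]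

theorem mem_agree {f s b u : M.D w} :
    M.Mem u (agree f s b) ↔ ∃ c, It u f b c ∧ It u s b c :=
  mem_sep.trans (exists_congr fun _ => and_congr force_itFml force_itFml)

@[simp] theorem map_agree (g : M.Hom w w') (f s b : M.D w) :
    g (agree f s b) = agree (g f) (g s) (g b) := by
  rw [agree, map_sep, agree]; congr 1; funext i; fin_cases i <;> rfl

namespace Seg

variable {B x : M.D w}

theorem map (h : Seg B x) (f : M.Hom w w') : Seg (f B) (f x) where
  zero := h.zero.imp (fun h => map_zeroS f ▸ M.mem_map f.isHom h)
    (fun h => map_zeroS f ▸ congrArg f h)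
  not_mem w'' g := h.not_mem w'' (g.comp f)
  succ w'' g := h.succ w'' (g.comp f)
  pred w'' g := h.pred w'' (g.comp f)
  inj w'' g := h.inj w'' (g.comp f)
  ind w'' g := h.ind w'' (g.comp f)

theorem mem_natS (h : Seg B x) {y : M.D w} (hy : M.Mem y B ∨ y = x) : M.Mem y natS := by
  refine h.ind w (.id w) natS y zeroS_mem_natS (fun w' g u d _ hu hd => ?_) hy
  rw [map_natS] at hu ⊢
  obtain ⟨rfl, -⟩ := pair_mem_succS.1 hd
  exact succOf_mem_natS hu

/-- The two clauses of `cycle` cannot clash because `x ∉ B`. -/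
theorem func_cycle (h : Seg B x) : Func (cycle B x) := by
  intro w' f a b c hb hc
  rw [map_cycle, pair_mem_cycle] at hb hc
  rcases hb with ⟨hb, hb'⟩ | ⟨rfl, rfl⟩ <;> rcases hc with ⟨hc, hc'⟩ | ⟨hc, rfl⟩
  · exact func_succS.eq hb' hc'
  · exact absurd (hc ▸ hb) (h.not_mem w' f)
  · exact absurd hc (h.not_mem w' f)
  · rfl

/-- Successor is one-to-one on `B`, and the only other value, zero, is not a successor. -/
theorem cycle_inj (h : Seg B x) {a b c : M.D w} (ha : M.Mem (pair a c) (cycle B x))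
    (hb : M.Mem (pair b c) (cycle B x)) : a = b := by
  rw [pair_mem_cycle] at ha hb
  rcases ha with ⟨ha, ha'⟩ | ⟨rfl, hc⟩ <;> rcases hb with ⟨hb, hb'⟩ | ⟨rfl, hc'⟩
  · exact h.inj w (.id w) a b c ha hb ha' hb'
  · exact absurd ((pair_mem_succS.1 ha').1.symm.trans hc') (succOf_ne_zeroS _)
  · exact absurd ((pair_mem_succS.1 hb').1.symm.trans hc) (succOf_ne_zeroS _)
  · rfl

/-- Iterating `cycle` or successor from zero gives the same value as long as `x` has not been
passed. -/
theorem it_cycle (h : Seg B x) (hC : M.Counting w) {u : M.D w} (hu : M.Mem u B ∨ u = x) :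
    It u (cycle B x) zeroS u := by
  -- The induction statement asks only that the two iterates agree, which is stratified.
  have : M.Mem u (agree (cycle B x) succS zeroS) := by
    refine h.ind w (.id w) _ u (mem_agree.2 ⟨_, It.zeroS _ _, It.zeroS _ _⟩)
      (fun w' g u d hu hu' hd => ?_) hu
    rw [map_agree, map_cycle, map_succS, map_zeroS, mem_agree] at hu' ⊢
    obtain ⟨rfl, hf⟩ := pair_mem_succS.1 hd
    obtain ⟨c, hc, hc'⟩ := hu'
    -- Counting identifies the iterate with `u ∈ B`, where `cycle` acts as successor.
    obtain rfl := (hC.map g).eq_of_it ((h.map g).mem_natS (.inl hu)) hc'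
    exact ⟨succOf c, (it_succOf hf (h.map g).func_cycle).2
      ⟨c, hc, pair_mem_cycle.2 (.inl ⟨hu, hd⟩)⟩, (it_succOf hf func_succS).2 ⟨c, hc', hd⟩⟩
  obtain ⟨c, hc, hc'⟩ := mem_agree.1 this
  obtain rfl := hC.eq_of_it (h.mem_natS hu) hc'
  exact hc

/-- Iterating `cycle` from zero `S u` times gives the image of `u` under `cycle`. So `S u`
determines that image, and `cycle` is one-to-one. -/
theorem succOf_inj (h : Seg B x) (hC : M.Counting w) {u v : M.D w} (hu : M.Mem u B ∨ u = x)
    (hv : M.Mem v B ∨ v = x) (huv : succOf u = succOf v) : u = v := by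
  have hfu := func_of_mem_natS (h.mem_natS hu)
  have hfv := func_of_mem_natS (h.mem_natS hv)
  obtain ⟨d, hd⟩ : ∃ d, M.Mem (pair u d) (cycle B x) := by
    rcases hu with hu | rfl
    · exact ⟨_, pair_mem_cycle.2 (.inl ⟨hu, pair_mem_succS.2 ⟨rfl, hfu⟩⟩)⟩
    · exact ⟨_, pair_mem_cycle.2 (.inr ⟨rfl, rfl⟩)⟩
  have h₁ := (it_succOf hfu h.func_cycle).2 ⟨u, h.it_cycle hC hu, hd⟩
  rw [huv, it_succOf hfv h.func_cycle] at h₁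
  obtain ⟨c, hc, hcd⟩ := h₁
  obtain rfl := It.eq hfv hc (h.it_cycle hC hv)
  exact h.cycle_inj hd hcd

/-- Otherwise `S x`, being nonzero, would be the successor of some `u ∈ B`; then `u = x` by
injectivity on `B ∪ {x}`, against `x ∉ B`. -/
theorem succOf_not_mem (h : Seg B x) (hC : M.Counting w) :
    ¬ (M.Mem (succOf x) B ∨ succOf x = x) := fun hx => by
  rcases h.pred w (.id w) _ hx with h0 | ⟨u, hu, hux⟩
  · exact succOf_ne_zeroS x h0
  · obtain rfl := h.succOf_inj hC (.inr rfl) (.inl hu) (pair_mem_succS.1 hux).1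
    exact h.not_mem w (.id w) hu

theorem next (h : Seg B x) (hC : M.Counting w) : Seg (insert B x) (succOf x) where
  zero := .inl (mem_insert.2 h.zero)
  not_mem w' f hx := by
    rw [map_succOf, map_insert, mem_insert] at hx
    exact (h.map f).succOf_not_mem (hC.map f) hx
  succ w' f u d hu hd := by
    rw [map_insert, mem_insert] at hu
    rw [map_insert, mem_insert, map_succOf]
    rcases hu with hu | rfl
    · exact .inl (h.succ w' f u d hu hd)
    · exact .inr (pair_mem_succS.1 hd).1
  pred w' f y hy := by
    rw [map_insert, mem_insert, map_succOf] at hy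
    simp only [map_insert, mem_insert]
    rcases hy with hy | rfl
    · exact (h.pred w' f y hy).imp_right fun ⟨u, hu, hd⟩ => ⟨u, .inl hu, hd⟩
    · exact .inr ⟨f x, .inr rfl, pair_succOf_mem_succS ((h.map f).mem_natS (.inr rfl))⟩
  inj w' f u v d hu hv hud hvd := by
    rw [map_insert, mem_insert] at hu hv
    exact (h.map f).succOf_inj (hC.map f) hu hv
      ((pair_mem_succS.1 hud).1.symm.trans (pair_mem_succS.1 hvd).1)
  ind w' f X y h0 hs hy := by
    have hBx : ∀ z, M.Mem z (f B) ∨ z = f x → M.Mem z X := fun z =>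
      h.ind w' f X z h0 fun w'' g u d hu => hs w'' g u d (by
        rw [map_insert, map_insert, mem_insert]; exact .inl hu)
    rw [map_insert, mem_insert, map_succOf] at hy
    rcases hy with hy | rfl
    · exact hBx y hy
    · exact hs w' (.id w') (f x) _ (by rw [map_insert]; exact mem_insert.2 (.inr rfl))
        (hBx _ (.inr rfl)) (pair_succOf_mem_succS ((h.map f).mem_natS (.inr rfl)))

theorem empty : Seg (empty : M.D w) zeroS where
  zero := .inr rfl
  not_mem w' f h := by rw [map_empty] at h; exact not_mem_empty h
  succ w' f u d hu := by rw [map_empty] at hu; exact absurd hu not_mem_empty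
  pred w' f y hy := by
    rw [map_empty, map_zeroS] at hy
    exact .inl (hy.resolve_left not_mem_empty)
  inj w' f u v d hu := by rw [map_empty] at hu; exact absurd hu not_mem_empty
  ind w' f X y h0 _ hy := by
    rw [map_empty, map_zeroS] at hy
    rwa [hy.resolve_left not_mem_empty]

end Seg

/-! ### Comparison of Church numbers -/

/-- `x ∈ B`, or `y` is not after `x` in a segment up to `x` -/
def belowFml (x B y z s : Fin n) : Fml n :=
  x ∈ₛ B ⋎ ex' fun C => segFml (C : Fin (n + 1)) x z s ⋏ (y ∈ₛ C ⋎ y =ₛ x)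

theorem force_belowFml {v : Fin n → M.D w} {x B y z s : Fin n} (hz : v z = zeroS)
    (hs : v s = succS) : M.Force (belowFml x B y z s) v ↔
      M.Mem (v x) (v B) ∨ ∃ C, Seg C (v x) ∧ (M.Mem (v y) C ∨ v y = v x) := by
  refine or_congr Iff.rfl (exists_congr fun C => and_congr ?_ Iff.rfl)
  exact force_segFml (v := Fin.cons C v) hz hs

/-- As `x` runs upward from zero, it stays in `B` until it leaves through a number whose segment
reaches `y`; from then on `Seg.next` keeps extending that segment. -/
theorem mem_or_exists_seg (hC : M.Counting w) {B y : M.D w}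
    (h0 : M.Mem zeroS B ∨ ∃ C, Seg C zeroS ∧ (M.Mem y C ∨ y = zeroS))
    (hs : ∀ (w' : M.W) (f : M.Hom w w') (u : M.D w'), M.Mem u (f B) → M.Mem (succOf u) (f B) ∨
      ∃ C, Seg C (succOf u) ∧ (M.Mem (f y) C ∨ f y = succOf u)) {x : M.D w} (hx : M.Mem x natS) :
    M.Mem x B ∨ ∃ C, Seg C x ∧ (M.Mem y C ∨ y = x) := by
  obtain ⟨X, hX⟩ : ∃ X : M.D w, ∀ {w' : M.W} (f : M.Hom w w') (u : M.D w'),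
      M.Mem u (f X) ↔ M.Mem u (f B) ∨ ∃ C, Seg C u ∧ (M.Mem (f y) C ∨ f y = u) :=
    ⟨sep (n := 4) (φ := belowFml 0 1 2 3 4) (.intro ![0, 1, 0, 0, 3] ⟨rfl, 1,
      stratifiedBy_segFml (k := 0) rfl rfl rfl rfl, rfl, rfl⟩) ![B, y, zeroS, succS],
      fun f u => mem_map_sep.trans (force_belowFml (map_zeroS f) (map_succS f))⟩
  refine (hX (.id w) x).1 (natS_induction X ((hX (.id w) _).2 h0) (fun w' f u _ hu => ?_) hx)
  rw [hX] at hu ⊢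
  rcases hu with hu | ⟨C, hCu, hy⟩
  · exact hs w' f u hu
  · exact .inr ⟨insert C u, hCu.next (hC.map f), .inl (mem_insert.2 hy)⟩

theorem exists_seg (hC : M.Counting w) {x : M.D w} (hx : M.Mem x natS) : ∃ B, Seg B x := by
  -- With `B` empty the first alternative never occurs, so a segment is carried along from zero.
  have := mem_or_exists_seg hC (B := empty) (y := zeroS) (.inr ⟨_, Seg.empty, .inr rfl⟩)
    (fun w' f u hu => by rw [map_empty] at hu; exact absurd hu not_mem_empty) hx
  obtain ⟨B, hB, -⟩ := this.resolve_left not_mem_empty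
  exact ⟨B, hB⟩

/-- The Church counting axiom implies that Church successor is one-to-one on the Church numbers. -/
theorem Counting.succOf_inj (hC : M.Counting w) {x y : M.D w} (hx : M.Mem x natS)
    (hy : M.Mem y natS) (h : succOf x = succOf y) : x = y := by
  obtain ⟨B, hB⟩ := exists_seg hC hy
  -- The exit from `B` can only be at `y` itself, for which `B` is a segment.
  have hxy : M.Mem x B ∨ ∃ C, Seg C x ∧ (M.Mem y C ∨ y = x) := by
    refine mem_or_exists_seg hC (hB.zero.imp_right fun h => ⟨B, by rw [h]; exact hB, .inr h.symm⟩)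
      (fun w' f u hu => ?_) hx
    refine (hB.succ w' f u _ hu (pair_succOf_mem_succS ((hB.map f).mem_natS (.inl hu)))).imp_right
      fun h => ⟨f B, by rw [h]; exact hB.map f, .inr h.symm⟩
  rcases hxy with hx | ⟨C, hCx, hy⟩
  · exact hB.succOf_inj hC (.inl hx) (.inr rfl) h
  · exact hCx.succOf_inj hC (.inr rfl) hy h

end KripkeModel

/-! ### Forcing of the conclusion -/

namespace KripkeFrame

variable {F : KripkeFrame} {n : ℕ} {w : F.W} {v : Fin n → F.D w}

theorem force_all_all_imp_imp {φ ψ χ : Fml (n + 2)}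
    (h : ∀ (w' : F.W) (f : F.Hom w w') (d e : F.D w'),
      F.Force φ (Fin.cons e (Fin.cons d (f ∘ v))) → F.Force ψ (Fin.cons e (Fin.cons d (f ∘ v))) →
        F.Force χ (Fin.cons e (Fin.cons d (f ∘ v)))) :
    F.Force (.all (.all (φ ⟹ ψ ⟹ χ))) v := by
  refine force_all_all_imp.2 fun w' f d e hφ w'' g hψ => ?_
  have hφ := hφ.mono g
  rw [comp_cons, comp_cons] at hφ hψ ⊢
  exact h w'' (g.comp f) (g d) (g e) hφ hψ

theorem force_all_all_all_imp_imp {φ ψ χ : Fml (n + 3)}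
    (h : ∀ (w' : F.W) (f : F.Hom w w') (d e k : F.D w'),
      F.Force φ (Fin.cons k (Fin.cons e (Fin.cons d (f ∘ v)))) →
      F.Force ψ (Fin.cons k (Fin.cons e (Fin.cons d (f ∘ v)))) →
        F.Force χ (Fin.cons k (Fin.cons e (Fin.cons d (f ∘ v))))) :
    F.Force (.all (.all (.all (φ ⟹ ψ ⟹ χ)))) v := by
  refine force_all_all_all_imp.2 fun w' f d e k hφ w'' g hψ => ?_
  have hφ := hφ.mono g
  rw [comp_cons, comp_cons, comp_cons] at hφ hψ ⊢
  exact h w'' (g.comp f) (g d) (g e) (g k) hφ hψ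

end KripkeFrame

namespace KripkeModel

variable {M : KripkeModel} {w w' : M.W} {n : ℕ}

/-- The set of all successors of members of `N` -/
noncomputable def posS : M.D w :=
  sep (n := 2) (φ := ex' fun x => x ∈ₛ (2 : Fin 4) ⋏ pairMem x 1 3)
    (.intro ![6, 7, 9] ⟨6, rfl, stratifiedBy_pairMem rfl rfl⟩) ![natS, succS]

theorem mem_posS {y : M.D w} : M.Mem y posS ↔ ∃ x, M.Mem x natS ∧ y = succOf x := by
  refine mem_sep.trans (exists_congr fun x => and_congr_right fun hx => force_pairMem.trans ?_)
  exact pair_mem_succS.trans (and_iff_left (func_of_mem_natS hx))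

@[simp] theorem map_posS (f : M.Hom w w') : f (posS : M.D w) = posS := by
  rw [posS, map_sep, posS]; congr 1; funext i
  fin_cases i
  · exact map_natS f
  · exact map_succS f

/-- Church successor restricted to `N` -/
noncomputable def succNat : M.D w :=
  sep (n := 2) (φ := ex' fun x => ex' fun y => isPair (2 : Fin 5) x y ⋏ x ∈ₛ (3 : Fin 5) ⋏
      pairMem (x : Fin 5) y 4)
    (.intro ![8, 7, 9] ⟨6, 6, stratifiedBy_isPair rfl rfl, rfl, stratifiedBy_pairMem rfl rfl⟩)
    ![natS, succS]

theorem mem_succNat {p : M.D w} :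
    M.Mem p succNat ↔ ∃ x, p = pair x (succOf x) ∧ M.Mem x natS := by
  refine mem_sep.trans (exists_congr fun x => ?_)
  constructor
  · rintro ⟨y, hp, hx, hy⟩
    obtain ⟨h, -⟩ := pair_mem_succS.1 (force_pairMem.1 hy)
    exact ⟨(force_isPair.1 hp).trans (congrArg (pair x) h), hx⟩
  · rintro ⟨hp, hx⟩
    exact ⟨succOf x, force_isPair.2 hp, hx, force_pairMem.2 (pair_succOf_mem_succS hx)⟩

@[simp] theorem map_succNat (f : M.Hom w w') : f (succNat : M.D w) = succNat := by
  rw [succNat, map_sep, succNat]; congr 1; funext i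
  fin_cases i
  · exact map_natS f
  · exact map_succS f

theorem pair_mem_succNat {x y : M.D w} :
    M.Mem (pair x y) succNat ↔ y = succOf x ∧ M.Mem x natS := by
  rw [mem_succNat]
  constructor
  · rintro ⟨g, h, hg⟩
    obtain ⟨rfl, rfl⟩ := pair_inj.1 h
    exact ⟨rfl, hg⟩
  · rintro ⟨rfl, hf⟩; exact ⟨x, rfl, hf⟩

theorem func_succNat : Func (succNat : M.D w) := fun w' f x y z hy hz => by
  rw [map_succNat, pair_mem_succNat] at hy hz
  rw [hy.1, hz.1]

theorem counting_of_force {v : Fin n → M.D w} {z s N : Fin n} (hz : v z = zeroS)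
    (hs : v s = succS) (hN : v N = natS) (h : M.Force (churchCounting z s N) v) :
    M.Counting w := by
  simp only [churchCounting, force_all', force_all_imp, force_ex, force_and, force_isAp, force_mem,
    Fin.cons_zero, Fin.cons_succ, Function.comp_apply, hz, hs, hN, map_zeroS, map_succS, map_natS,
    exists_eq_left] at h
  exact fun w' f j hj => (h w' f j hj).symm

theorem Counting.force_oneOneOn {v : Fin n → M.D w} {s N : Fin n} (hC : M.Counting w)
    (hs : v s = succS) (hN : v N = natS) : M.Force (oneOneOn s N) v := by
  refine force_all_imp.2 fun w₁ f₁ x hx => force_all_imp.2 fun w₂ f₂ y hy => ?_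
  rintro w₃ f₃ ⟨p, hpx, hpy⟩
  have hx := (hx.mono f₂).mono f₃
  have hy := hy.mono f₃
  simp only [force_mem, force_isAp, force_eq, Fin.cons_zero, Fin.cons_succ, Function.comp_apply,
    hs, hN, map_natS, map_succS] at hx hy hpx hpy ⊢
  rw [(func_of_mem_natS hx).ap_succS] at hpx
  rw [(func_of_mem_natS hy).ap_succS] at hpy
  exact (((hC.map f₁).map f₂).map f₃).succOf_inj hx hy (hpx.symm.trans hpy)

/-- Successor maps the Church numbers onto `posS`, which lacks zero; counting enters only through
injectivity. -/
theorem Counting.force_isInfinite {v : Fin n → M.D w} {N : Fin n} (hC : M.Counting w)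
    (hN : v N = natS) : M.Force (isInfinite N) v := by
  refine ⟨posS, ?_, ?_, succNat, ?_, force_isFunc.2 func_succNat, ⟨?_, ?_, ?_⟩, ?_⟩
  · refine force_all_imp.2 fun w₁ f₁ x hx => ?_
    simp only [force_mem, Fin.cons_zero, Fin.cons_succ, Function.comp_apply, hN, map_natS,
      map_posS] at hx ⊢
    obtain ⟨u, hu, rfl⟩ := mem_posS.1 hx
    exact succOf_mem_natS hu
  · intro w₁ f₁ h
    simp only [force_eq, Fin.cons_zero, Fin.cons_succ, Function.comp_apply, hN, map_natS,
      map_posS] at h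
    obtain ⟨u, -, hu⟩ := mem_posS.1 (h ▸ zeroS_mem_natS : M.Mem zeroS posS)
    exact succOf_ne_zeroS u hu.symm
  · refine force_all_imp.2 fun w₁ f₁ p hp => ?_
    simp only [force_mem, force_ex, force_isPair, Fin.cons_zero, Fin.cons_succ, Function.comp_apply,
      map_succNat] at hp ⊢
    obtain ⟨x, rfl, -⟩ := mem_succNat.1 hp
    exact ⟨x, _, rfl⟩
  · refine force_all_imp.2 fun w₁ f₁ x hx => ?_
    simp only [force_mem, force_ex, force_and, force_pairMem, force_all', force_all_imp, force_eq,
      Fin.cons_zero, Fin.cons_succ, Function.comp_apply, hN, map_natS, map_posS,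
      map_succNat] at hx ⊢
    refine ⟨succOf x, pair_mem_succNat.2 ⟨rfl, hx⟩, mem_posS.2 ⟨x, hx, rfl⟩, fun w₂ f₂ y hy => ?_⟩
    rw [map_succOf]
    exact (pair_mem_succNat.1 hy).1
  · refine force_all_all_all_imp_imp fun w₁ f₁ x u y hx hu => ?_
    simp only [force_pairMem, force_eq, Fin.cons_zero, Fin.cons_succ, Function.comp_apply,
      map_succNat, pair_mem_succNat] at hx hu ⊢
    exact (hC.map f₁).succOf_inj hx.2 hu.2 (hx.1.symm.trans hu.1)
  · refine force_all_all_imp_imp fun w₁ f₁ x y hx _ => ?_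
    simp only [force_pairMem, force_mem, Fin.cons_zero, Fin.cons_succ, Function.comp_apply,
      map_succNat, pair_mem_succNat, hN, map_natS] at hx ⊢
    exact hx.2
  · refine force_all_imp.2 fun w₁ f₁ y hy => ?_
    simp only [force_pairMem, force_ex, force_and, force_mem, Fin.cons_zero, Fin.cons_succ,
      Function.comp_apply, map_succNat, pair_mem_succNat, hN, map_natS, map_posS] at hy ⊢
    obtain ⟨x, hx, rfl⟩ := mem_posS.1 hy
    exact ⟨x, hx, rfl, hx⟩

end KripkeModel

end INF

open INF KripkeFrame KripkeModel in
/-- INF proves that Church zero, Church successor and the set of Church numbers exist, and that for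
these sets the Church counting axiom implies that the set of Church numbers is infinite and Church
successor is one-to-one on it. -/
theorem mainTheorem2 :
    INF.Proves (n := 0) []
      ((INF.ex' fun zero => INF.ex' fun s => INF.ex' fun N => INF.isChurch zero s N) ⋏
       (INF.all' fun zero => INF.all' fun s => INF.all' fun N =>
          INF.isChurch zero s N ⟹
            INF.churchCounting zero s N ⟹
              (INF.isInfinite N ⋏ INF.oneOneOn s N))) := by
  refine proves_of_force fun M w v =>
    ⟨⟨zeroS, succS, natS, force_isChurch.2 ⟨rfl, rfl, rfl⟩⟩, ?_⟩
  refine force_all_all_all_imp.2 fun w' f z s N hChurch w'' g hC => ?_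
  -- The defining formulas determine the three sets, so the universally quantified ones are the
  -- concrete ones.
  obtain ⟨hz, hs, hN⟩ := force_isChurch.1 (hChurch.mono g)
  have := counting_of_force hz hs hN hC
  exact ⟨this.force_isInfinite hN, this.force_oneOneOn hs hN⟩
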